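/- Let $N\ge 1$, $\bar{\mathfrak t}=\bigoplus_{i=1}^N\mathbb C\epsilon_i^\vee$, $\mathfrak t'=\bar{\mathfrak t}\oplus\mathbb Cc$, $\bar P=\bigoplus_{i=1}^N\mathbb Z\epsilon_i$, $\bar W=\mathfrak S_N$ and $W=\bar W\ltimes\bar P$, whose elements are written $t_\eta\sigma$ ($\eta\in\bar P$, $\sigma\in\bar W$). The group $W$ acts on $\mathfrak t'$ by $\sigma(\epsilon_i^\vee)=\epsilon_{\sigma(i)}^\vee$, $\sigma(c)=c$, $t_\eta(\xi)=\xi-\eta(\xi)c$, and on $\bar P\oplus\mathbb Z\delta$ by $\sigma(\epsilon_i)=\epsilon_{\sigma(i)}$, $\sigma(\delta)=\delta$, $t_\eta(a+k\delta)=a+(k-(\eta,a))\delta$. Put $\alpha_{ij}=\epsilon_i-\epsilon_j$, $R=\{\alpha_{ij}+k\delta: i\ne j,\ k\in\mathbb Z\}$, $\bar R_+=\{\alpha_{ij}: i<j\}$, $R_+=\{\alpha+k\delta:\alpha\in\bar R_+,k\ge0\}\sqcup\{-\alpha+k\delta:\alpha\in\bar R_+,k>0\}$, $S(w)=R_+\cap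 w^{-1}(R\setminus R_+)$, $\bar S(w)=S(w)\cap\bar R_+$ and $l(w)=\#S(w)$. Let $\alpha_i=\alpha_{i,i+1}$ ($1\le i\le N-1$), $\alpha_0=\delta-(\epsilon_1-\epsilon_N)$, let $s_i$ be the reflection in $\alpha_i$ (so $s_0=t_{\epsilon_1-\epsilon_N}s_{\alpha_{1N}}$), and let $\pi=t_{\epsilon_1}s_1\cdots s_{N-1}$. Write $\alpha^\vee\in\mathfrak t'$ for the image of $\alpha$ under $\epsilon_i\mapsto\epsilon_i^\vee$, $\delta\mapsto c$, and $(\zeta,\alpha)=\zeta(\alpha^\vee)$ for a weight $\zeta$; as linear forms on $\mathfrak t'$, $\epsilon_i(c)=0$ and $\delta=0$. The degenerate double affine Hecke algebra $\mathcal H$ is the unital associative $\mathbb C$-algebra generated by $\mathbb C[W]$ and $S[\mathfrak t']$ with the relations $s_i\xi-s_i(\xi)s_i=-\alpha_i(\xi)$ ($0\le i\le N-1$) and $\pi\xi=\pi(\xi)\pi$ for $\xi\in\mathfrak t'$; as a vector space it is $\mathbb C[W]\otimes S[\mathfrak t']$. Let $\bar{\mathcal H}\subset\mathcal H$ be the subalgebra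 generated by $\bar W$ and $\bar{\mathfrak t}$. For a reduced expression $w=\pi^ks_{j_1}\cdots s_{j_m}$ with $m=l(w)$, put $\varphi_w=\pi^k\varphi_{j_1}\cdots\varphi_{j_m}\in\mathcal H$, where $\varphi_i=1+s_i\alpha_i^\vee$; this does not depend on the reduced expression, and $\varphi_w\in\bar{\mathcal H}$ for $w\in\bar W$. Let $\beta$ be an ordered partition of $N$ into positive parts; it cuts $\{1,\dots,N\}$ into consecutive blocks. Let $\bar\Pi_\beta$ be the set of the $\alpha_i$ ($1\le i\le N-1$) with $i,i+1$ in the same block, $\bar W_\beta=\langle s_\alpha:\alpha\in\bar\Pi_\beta\rangle$, $W^\beta=\{w\in W: l(wu)\ge l(w)\text{ for all }u\in\bar W_\beta\}$ and $\bar W^\beta=W^\beta\cap\bar W$. Let $\mathcal H_\beta\subset\mathcal H$ (resp. $\bar{\mathcal H}_\beta\subset\bar{\mathcal H}$) be the subalgebra generated by $\bar W_\beta$ and $\mathfrak t'$ (resp. $\bar{\mathfrak t}$). Let $\zeta\in(\mathfrak t')^*$ (resp. $\bar{\mathfrak t}^*$) satisfy $(\zeta,\alpha)=-1$ for all $\alpha\in\bar\Pi_\beta$.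 Let $\mathbb C1_\zeta$ be the one-dimensional $\mathcal H_\beta$-module (resp. $\bar{\mathcal H}_\beta$-module), well defined, with $w1_\zeta=1_\zeta$ for $w\in\bar W_\beta$ and $\xi1_\zeta=\zeta(\xi)1_\zeta$ for $\xi\in\mathfrak t'$ (resp. $\bar{\mathfrak t}$). Put $\mathcal Y_\beta(\zeta)=\mathcal H\otimes_{\mathcal H_\beta}\mathbb C1_\zeta$ (resp. $\bar{\mathcal Y}_\beta(\zeta)=\bar{\mathcal H}\otimes_{\bar{\mathcal H}_\beta}\mathbb C1_\zeta$) and $\mathbf 1_\zeta=1\otimes1_\zeta$. The weight $\zeta$ is called $\beta$-generic if $(\zeta,\alpha)\notin\{1,0,-1\}$ for all $\alpha\in\bigcup_{w\in W^\beta}S(w)$ (resp. $\alpha\in\bigcup_{w\in\bar W^\beta}\bar S(w)$). **Proposition.** (i) If $\zeta\in(\mathfrak t')^*$ as above is $\beta$-generic, then $\{\varphi_w\mathbf 1_\zeta: w\in W^\beta\}$ is a basis of $\mathcal Y_\beta(\zeta)$ over $\mathbb C$; if moreover $(\zeta,\delta)=\zeta(c)\ne0$, then $\mathcal Y_\beta(\zeta)$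 is an irreducible $\mathcal H$-module. (ii) If $\zeta\in\bar{\mathfrak t}^*$ as above is $\beta$-generic, then $\bar{\mathcal Y}_\beta(\zeta)$ is an irreducible $\bar{\mathcal H}$-module with the basis $\{\varphi_w\mathbf 1_\zeta: w\in\bar W^\beta\}$ over $\mathbb C$. -/

import Mathlib

open scoped TensorProduct

noncomputable section

namespace DDAHA

/-! Throughout `N ≥ 1`.  The coordinates `1, …, N` of `gl_N` are written as `0, …, N - 1 : Fin N`,
so that the basis vector numbered `i` (counted from one) is `Pi.single (i - 1) 1` here. -/

/-! ### The affine Weyl group and its actions -/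

/-- The symmetric group acts on the weight lattice `ℤ^N`, with `σ (ε i) = ε (σ i)`. -/
def permAut (N : ℕ) : Equiv.Perm (Fin N) →* MulAut (Multiplicative (Fin N → ℤ)) where
  toFun σ :=
    { toFun := fun η => Multiplicative.ofAdd (fun j => Multiplicative.toAdd η (σ.symm j))
      invFun := fun η => Multiplicative.ofAdd (fun j => Multiplicative.toAdd η (σ j))
      left_inv := fun η => by
        apply Multiplicative.toAdd.injective; funext j; simp
      right_inv := fun η => by
        apply Multiplicative.toAdd.injective; funext j; simp
      map_mul' := fun _ _ => rfl }
  map_one' := rfl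
  map_mul' _ _ := rfl

/-- The (extended) affine Weyl group `W = S_N ⋉ ℤ^N`.  The element `⟨η, σ⟩` is `t_η · σ`. -/
abbrev AffW (N : ℕ) : Type := Multiplicative (Fin N → ℤ) ⋊[permAut N] Equiv.Perm (Fin N)

/-- The translation `t_η`. -/
def transl {N : ℕ} (η : Fin N → ℤ) : AffW N := SemidirectProduct.inl (Multiplicative.ofAdd η)

/-- The inclusion of the finite Weyl group `S_N` in `W`. -/
def fin {N : ℕ} (σ : Equiv.Perm (Fin N)) : AffW N := SemidirectProduct.inr σ

/-- The basis vector `ε i` of the weight lattice. -/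
def eps {N : ℕ} (i : Fin N) : Fin N → ℤ := Pi.single i 1

/-- The space `𝔱' = 𝔱bar ⊕ ℂ c`, where `𝔱bar = ℂ^N`. -/
abbrev TPrime (N : ℕ) : Type := (Fin N → ℂ) × ℂ

/-- The element `c` of `𝔱'`. -/
def central (N : ℕ) : TPrime N := (0, 1)

/-- The action of `W` on `𝔱'`:  `σ (ε i) = ε (σ i)`, `σ c = c` and `t_η (ξ) = ξ - η(ξ) c`. -/
def actT {N : ℕ} (w : AffW N) (ξ : TPrime N) : TPrime N :=
  (fun j => ξ.1 (w.right.symm j),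
    ξ.2 - ∑ j, (Multiplicative.toAdd w.left j : ℂ) * ξ.1 (w.right.symm j))

/-- The lattice `ℤ^N ⊕ ℤ δ`, which contains the affine roots.  The pair `(a, k)` is `a + k δ`. -/
abbrev RootLattice (N : ℕ) : Type := (Fin N → ℤ) × ℤ

/-- The action of `W` on `ℤ^N ⊕ ℤ δ`:  `t_η (a + k δ) = a + (k - (η, a)) δ`. -/
def actR {N : ℕ} (w : AffW N) (a : RootLattice N) : RootLattice N :=
  (fun j => a.1 (w.right.symm j),
    a.2 - ∑ j, Multiplicative.toAdd w.left j * a.1 (w.right.symm j))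

/-- The linear form on `𝔱'` given by `a + k δ` (the form `δ` vanishes on `𝔱'`). -/
def rootEval {N : ℕ} (a : RootLattice N) (ξ : TPrime N) : ℂ := ∑ j, (a.1 j : ℂ) * ξ.1 j

/-- The vector of `𝔱'` that corresponds to `a + k δ` under `ε i ↦ ε i`, `δ ↦ c`. -/
def coroot {N : ℕ} (a : RootLattice N) : TPrime N := (fun j => (a.1 j : ℂ), (a.2 : ℂ))

/-! ### Affine roots and lengths -/

/-- The affine root `α_{ij} + k δ`, with `α_{ij} = ε i - ε j`. -/
def root {N : ℕ} (i j : Fin N) (k : ℤ) : RootLattice N := (eps i - eps j, k)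

/-- The set `R` of roots. -/
def roots (N : ℕ) : Set (RootLattice N) := {a | ∃ (i j : Fin N) (k : ℤ), i ≠ j ∧ a = root i j k}

/-- The set `R_+` of positive roots. -/
def posRoots (N : ℕ) : Set (RootLattice N) :=
  {a | ∃ (i j : Fin N) (k : ℤ), i < j ∧ 0 ≤ k ∧ a = root i j k} ∪
  {a | ∃ (i j : Fin N) (k : ℤ), i < j ∧ 0 < k ∧ a = root j i k}

/-- The set of positive roots of the finite root system. -/
def finPosRoots (N : ℕ) : Set (RootLattice N) := {a | ∃ i j : Fin N, i < j ∧ a = root i j 0}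

/-- `S(w) = R_+ ∩ w⁻¹ (R_-)`, where `R_- = R \ R_+`. -/
def inversions {N : ℕ} (w : AffW N) : Set (RootLattice N) :=
  {a | a ∈ posRoots N ∧ actR w a ∈ roots N \ posRoots N}

/-- The length `l(w)`, the number of elements of `S(w)`. -/
def length {N : ℕ} (w : AffW N) : ℕ := (inversions w).ncard

section Simple

variable {N : ℕ} [NeZero N]

/-- The simple roots `α_i`, `i ∈ ℤ/N`:  `α_0 = δ - (ε_1 - ε_N)` and `α_i = ε_i - ε_{i+1}` for
`i = 1, …, N - 1`, with `ε` counted from one.  Subtraction in `Fin N` is cyclic. -/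
def simpleRoot (i : Fin N) : RootLattice N := root (i - 1) i (if i = 0 then 1 else 0)

/-- The simple reflections `s_i`, `i ∈ ℤ/N`: the reflection in a root `a + k δ` is
`t_{-k a} · s_a`. -/
def simpleRefl (i : Fin N) : AffW N :=
  transl (-(if i = 0 then (1 : ℤ) else 0) • (eps (i - 1) - eps i)) * fin (Equiv.swap (i - 1) i)

variable (N) in
/-- `π = t_{ε_1} · s_1 ⋯ s_{N-1}`; the product `s_1 ⋯ s_{N-1}` is the cyclic permutation
`i ↦ i + 1`. -/
def piElt : AffW N := transl (eps 0) * fin (finRotate N)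

end Simple

/-! ### The degenerate double affine Hecke algebra -/

section Algebra

variable (N : ℕ) [NeZero N]

/-- The defining relations of `H`, on generators `w ∈ W` and `ξ ∈ 𝔱'`.  The first six say that
`ℂ[W] → H` and `S[𝔱'] → H` are well-defined homomorphisms of algebras. -/
inductive Rel : FreeAlgebra ℂ (AffW N ⊕ TPrime N) → FreeAlgebra ℂ (AffW N ⊕ TPrime N) → Prop
  | one : Rel (FreeAlgebra.ι ℂ (Sum.inl 1)) 1
  | mul (v w : AffW N) : Rel (FreeAlgebra.ι ℂ (Sum.inl (v * w)))
      (FreeAlgebra.ι ℂ (Sum.inl v) * FreeAlgebra.ι ℂ (Sum.inl w))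
  | add (ξ η : TPrime N) : Rel (FreeAlgebra.ι ℂ (Sum.inr (ξ + η)))
      (FreeAlgebra.ι ℂ (Sum.inr ξ) + FreeAlgebra.ι ℂ (Sum.inr η))
  | smul (a : ℂ) (ξ : TPrime N) : Rel (FreeAlgebra.ι ℂ (Sum.inr (a • ξ)))
      (a • FreeAlgebra.ι ℂ (Sum.inr ξ))
  | comm (ξ η : TPrime N) : Rel
      (FreeAlgebra.ι ℂ (Sum.inr ξ) * FreeAlgebra.ι ℂ (Sum.inr η))
      (FreeAlgebra.ι ℂ (Sum.inr η) * FreeAlgebra.ι ℂ (Sum.inr ξ))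
  | refl (i : Fin N) (ξ : TPrime N) : Rel
      (FreeAlgebra.ι ℂ (Sum.inl (simpleRefl i)) * FreeAlgebra.ι ℂ (Sum.inr ξ)
        - FreeAlgebra.ι ℂ (Sum.inr (actT (simpleRefl i) ξ))
          * FreeAlgebra.ι ℂ (Sum.inl (simpleRefl i)))
      (algebraMap ℂ _ (-rootEval (simpleRoot i) ξ))
  | pi (ξ : TPrime N) : Rel
      (FreeAlgebra.ι ℂ (Sum.inl (piElt N)) * FreeAlgebra.ι ℂ (Sum.inr ξ))
      (FreeAlgebra.ι ℂ (Sum.inr (actT (piElt N) ξ)) * FreeAlgebra.ι ℂ (Sum.inl (piElt N)))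

/-- The degenerate double affine Hecke algebra `H`. -/
def H : Type := RingQuot (Rel N)

instance : Ring (H N) := inferInstanceAs (Ring (RingQuot (Rel N)))

instance : Algebra ℂ (H N) := inferInstanceAs (Algebra ℂ (RingQuot (Rel N)))

variable {N}

/-- The element `w` of `H`, for `w ∈ W`. -/
def ofW (w : AffW N) : H N := RingQuot.mkAlgHom ℂ (Rel N) (FreeAlgebra.ι ℂ (Sum.inl w))

/-- The element `ξ` of `H`, for `ξ ∈ 𝔱'`. -/
def ofT (ξ : TPrime N) : H N := RingQuot.mkAlgHom ℂ (Rel N) (FreeAlgebra.ι ℂ (Sum.inr ξ))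

variable (N) in
/-- The degenerate affine Hecke algebra `Hbar`: the subalgebra of `H` generated by the finite Weyl
group and `𝔱bar`. -/
def Hbar : Subalgebra ℂ (H N) :=
  Algebra.adjoin ℂ
    (Set.range (fun σ : Equiv.Perm (Fin N) => ofW (fin σ)) ∪
      Set.range (fun ξ : Fin N → ℂ => ofT (ξ, 0)))

/-- The element `σ` of `Hbar`, for `σ ∈ S_N`. -/
def barW (σ : Equiv.Perm (Fin N)) : Hbar N :=
  ⟨ofW (fin σ), Algebra.subset_adjoin (Or.inl ⟨σ, rfl⟩)⟩

/-- The element `ξ` of `Hbar`, for `ξ ∈ 𝔱bar`. -/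
def barT (ξ : Fin N → ℂ) : Hbar N :=
  ⟨ofT (ξ, 0), Algebra.subset_adjoin (Or.inr ⟨ξ, rfl⟩)⟩

/-! ### Intertwiners -/

/-- The intertwiner `φ_i = 1 + s_i α_i^∨`. -/
def phiSimple (i : Fin N) : H N := 1 + ofW (simpleRefl i) * ofT (coroot (simpleRoot i))

/-- `(k, [j_1, …, j_m])` is a reduced expression of `w`:  `w = π^k s_{j_1} ⋯ s_{j_m}` with
`m = l(w)`. -/
def IsReducedExpr (w : AffW N) (e : ℤ × List (Fin N)) : Prop :=
  w = piElt N ^ e.1 * (e.2.map simpleRefl).prod ∧ e.2.length = length w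

open Classical in
/-- The intertwiner `φ_w = φ_π^k φ_{j_1} ⋯ φ_{j_m}`, for a reduced expression
`w = π^k s_{j_1} ⋯ s_{j_m}`, with `φ_π = π`.  A reduced expression always exists, and the product
does not depend on it since the `φ_i` satisfy the braid relations. -/
def phi (w : AffW N) : H N :=
  if h : ∃ e : ℤ × List (Fin N), IsReducedExpr w e then
    ofW (piElt N ^ h.choose.1) * (h.choose.2.map phiSimple).prod
  else 0

/-! ### Parabolic data attached to an ordered partition `β` of `N` -/

/-- `α_{ij}` is a simple root of the finite root system that belongs to `β`: the indices `i`, `j`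
are consecutive and lie in the same block of `β`. -/
def IsBetaSimple (β : Composition N) (i j : Fin N) : Prop :=
  (i : ℕ) + 1 = (j : ℕ) ∧ β.index i = β.index j

/-- The parabolic subgroup of `S_N` attached to `β`. -/
def parabolic (β : Composition N) : Subgroup (Equiv.Perm (Fin N)) :=
  Subgroup.closure {σ | ∃ i j : Fin N, IsBetaSimple β i j ∧ σ = Equiv.swap i j}

/-- `W^β = {w ∈ W | l(w u) ≥ l(w) for all u in the parabolic subgroup}`. -/
def cosetReps (β : Composition N) : Set (AffW N) :=
  {w | ∀ u ∈ parabolic β, length w ≤ length (w * fin u)}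

/-- The intersection of `W^β` with the finite Weyl group. -/
def barCosetReps (β : Composition N) : Set (Equiv.Perm (Fin N)) := {σ | fin σ ∈ cosetReps β}

/-- The weights `ζ ∈ (𝔱')^*` with `ζ(α) = -1` for every simple root `α` that belongs to `β`. -/
def weights (β : Composition N) : Set (Module.Dual ℂ (TPrime N)) :=
  {ζ | ∀ i j : Fin N, IsBetaSimple β i j → ζ (coroot (root i j 0)) = -1}

/-- The weights `ζ ∈ 𝔱bar^*` with `ζ(α) = -1` for every simple root `α` that belongs to `β`. -/
def barWeights (β : Composition N) : Set (Module.Dual ℂ (Fin N → ℂ)) :=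
  {ζ | ∀ i j : Fin N, IsBetaSimple β i j → ζ (coroot (root i j 0)).1 = -1}

/-- `β`-genericity of `ζ ∈ (𝔱')^*`:  `(ζ, α) ∉ {1, 0, -1}` for all `α` in the union of the `S(w)`,
`w ∈ W^β`. -/
def IsGeneric (β : Composition N) (ζ : Module.Dual ℂ (TPrime N)) : Prop :=
  ∀ w ∈ cosetReps β, ∀ a ∈ inversions w, ζ (coroot a) ∉ ({1, 0, -1} : Set ℂ)

/-- `β`-genericity of `ζ ∈ 𝔱bar^*`. -/
def IsBarGeneric (β : Composition N) (ζ : Module.Dual ℂ (Fin N → ℂ)) : Prop :=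
  ∀ σ ∈ barCosetReps β, ∀ a ∈ inversions (fin σ) ∩ finPosRoots N,
    ζ (coroot a).1 ∉ ({1, 0, -1} : Set ℂ)

/-- The parabolic subalgebra `H_β` of `H`, generated by the parabolic subgroup and `𝔱'`. -/
def parabolicH (β : Composition N) : Subalgebra ℂ (H N) :=
  Algebra.adjoin ℂ ((fun σ => ofW (fin σ)) '' (parabolic β : Set (Equiv.Perm (Fin N))) ∪
    Set.range (fun ξ : TPrime N => ofT ξ))

/-- The parabolic subalgebra of `Hbar`, generated by the parabolic subgroup and `𝔱bar`. -/
def parabolicHbar (β : Composition N) : Subalgebra ℂ (Hbar N) :=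
  Algebra.adjoin ℂ (barW '' (parabolic β : Set (Equiv.Perm (Fin N))) ∪
    Set.range (fun ξ : Fin N → ℂ => barT ξ))

/-- `χ` is the character by which `H_β` acts on the one-dimensional module `ℂ 1_ζ`:
`w ↦ 1` and `ξ ↦ ζ(ξ)`.  There is at most one, as these elements generate `H_β`. -/
def IsCharacter (β : Composition N) (ζ : Module.Dual ℂ (TPrime N))
    (χ : parabolicH β →ₐ[ℂ] ℂ) : Prop :=
  (∀ x : parabolicH β, ∀ σ ∈ parabolic β, (x : H N) = ofW (fin σ) → χ x = 1) ∧
  (∀ x : parabolicH β, ∀ ξ : TPrime N, (x : H N) = ofT ξ → χ x = ζ ξ)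

/-- The same for the parabolic subalgebra of `Hbar`. -/
def IsBarCharacter (β : Composition N) (ζ : Module.Dual ℂ (Fin N → ℂ))
    (χ : parabolicHbar β →ₐ[ℂ] ℂ) : Prop :=
  (∀ x : parabolicHbar β, ∀ σ ∈ parabolic β, (x : Hbar N) = barW σ → χ x = 1) ∧
  (∀ x : parabolicHbar β, ∀ ξ : Fin N → ℂ, (x : Hbar N) = barT ξ → χ x = ζ ξ)

end Algebra

/-! ### Induced modules -/

section Induced

variable {A : Type} [Ring A] [Algebra ℂ A] {B : Subalgebra ℂ A}

/-- The `A`-submodule of `A ⊗_ℂ ℂ` that is spanned by `a b ⊗ z - a ⊗ χ(b) z`, `b ∈ B`. -/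
def balancing (χ : B →ₐ[ℂ] ℂ) : Submodule A (A ⊗[ℂ] ℂ) :=
  Submodule.span A {x | ∃ (a : A) (b : B) (z : ℂ), x = (a * (b : A)) ⊗ₜ[ℂ] z - a ⊗ₜ[ℂ] (χ b * z)}

/-- The induced module `A ⊗_B ℂ_χ`, where `B` acts on `ℂ_χ = ℂ` by the character `χ`. -/
abbrev Induced (χ : B →ₐ[ℂ] ℂ) : Type := (A ⊗[ℂ] ℂ) ⧸ balancing χ

/-- The cyclic vector `1 ⊗ 1` of the induced module. -/
def cyclicVector (χ : B →ₐ[ℂ] ℂ) : Induced χ :=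
  Submodule.Quotient.mk ((1 : A) ⊗ₜ[ℂ] (1 : ℂ))

end Induced

/-- The family `f` is a basis of the complex vector space `V`. -/
def IsBasis {ι V : Type} [AddCommGroup V] [Module ℂ V] (f : ι → V) : Prop :=
  LinearIndependent ℂ f ∧ Submodule.span ℂ (Set.range f) = ⊤

end DDAHA

end

/-! Everything combinatorial rests on one additive function, the height `ht`, which takes the value
`N k + j - i` on `root i j k`. A root is positive exactly when its height is positive, simple roots
have height one, and `π` preserves the heights of roots. This gives the effect of `s_i` on
inversions, the existence of reduced expressions, and the uniqueness of minimal coset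
representatives.

Linear independence needs a module that is known to be large. Instead of a PBW theorem, the formula
`ξ · w = ζ(w⁻¹ξ) w + ∑ a(w⁻¹ξ) w s_a`, summed over `a ∈ S(w)`, is shown to define an action of `H`
on `ℂ[W]` (`principal`). If `ζ` is `-1` on the simple roots of `β`, the kernel of `ℂ[W] → ℂ[W /
W_β]` is a submodule (`principal_mem_cosetKer`). This yields both the character of `H_β` and linear
forms on the induced module that separate the cosets.

The intertwiners satisfy `ξ φ_j = φ_j s_j(ξ)`, so `φ_w 1_ζ` is a vector of weight `ξ ↦ ζ(w⁻¹ξ)`.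
Expanded, it is `c w 1_ζ` plus shorter terms, where `c` is the product of the numbers `ζ(a)`, `a ∈
S(w)` (`wordPhi_smul_sub_mem`). Genericity makes `c` nonzero, and triangularity gives the basis.

For irreducibility, the weights of the basis vectors are pairwise different, so a nonzero submodule
contains some `φ_w 1_ζ`. Since `φ_j² = 1 - (α_j^∨)²` and the values `±1` are excluded, applying the
intertwiners in reverse leads back to `1_ζ`. If two weights agreed, some `x ≠ 1` would fix `ζ`. Then
a root orthogonal to `ζ` has an `x`-orbit of total height zero, so `x` inverts such a root
(`exists_inversion_of_fixed`), and this contradicts genericity. The condition `ζ(c) ≠ 0` excludes a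
leftover multiple of `δ` in the orbit sum; in the finite group there is none. Both algebras are
treated at once through `IsInducedFamily`. -/

namespace DDAHA

/-! ### The actions of the affine Weyl group -/

section Actions

variable {N : ℕ}

/-- The translation part of an element of the affine Weyl group. -/
def shift (w : AffW N) (j : Fin N) : ℤ := Multiplicative.toAdd w.left j

theorem actT_eq (w : AffW N) (ξ : TPrime N) :
    actT w ξ = (fun j => ξ.1 (w.right.symm j),
      ξ.2 - ∑ j, (shift w (w.right j) : ℂ) * ξ.1 j) := by
  refine Prod.ext rfl ?_
  change _ - _ = _ - _
  rw [← Equiv.sum_comp w.right]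
  simp [shift]

theorem actR_eq (w : AffW N) (a : RootLattice N) :
    actR w a = (fun j => a.1 (w.right.symm j), a.2 - ∑ j, shift w (w.right j) * a.1 j) := by
  refine Prod.ext rfl ?_
  change _ - _ = _ - _
  rw [← Equiv.sum_comp w.right]
  simp [shift]

theorem shift_mul (v w : AffW N) (j : Fin N) :
    shift (v * w) j = shift v j + shift w (v.right.symm j) := rfl

@[simp] theorem shift_one (j : Fin N) : shift (1 : AffW N) j = 0 := rfl

@[simp] theorem shift_fin (σ : Equiv.Perm (Fin N)) (j : Fin N) : shift (fin σ) j = 0 := rfl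

@[simp] theorem fin_right (σ : Equiv.Perm (Fin N)) : (fin σ).right = σ := rfl

theorem fin_mul (σ τ : Equiv.Perm (Fin N)) : fin (σ * τ) = fin σ * fin τ :=
  map_mul SemidirectProduct.inr σ τ

@[simp] theorem fin_one : fin (1 : Equiv.Perm (Fin N)) = 1 := rfl

theorem fin_inv (σ : Equiv.Perm (Fin N)) : fin σ⁻¹ = (fin σ)⁻¹ :=
  map_inv SemidirectProduct.inr σ

theorem affW_ext {v w : AffW N} (h₁ : v.right = w.right) (h₂ : ∀ j, shift v j = shift w j) :
    v = w :=
  SemidirectProduct.ext (Multiplicative.toAdd.injective (funext h₂)) h₁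

theorem actT_mul (v w : AffW N) (ξ : TPrime N) : actT (v * w) ξ = actT v (actT w ξ) := by
  simp only [actT_eq]
  refine Prod.ext rfl ?_
  simp only [shift_mul, SemidirectProduct.mul_right, Equiv.Perm.mul_apply,
    Equiv.symm_apply_apply, Int.cast_add, add_mul, Finset.sum_add_distrib]
  rw [← Equiv.sum_comp w.right (fun j => (shift v (v.right j) : ℂ) * ξ.1 (w.right.symm j))]
  simp only [Equiv.symm_apply_apply]
  ring

theorem actR_mul (v w : AffW N) (a : RootLattice N) : actR (v * w) a = actR v (actR w a) := by
  simp only [actR_eq]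
  refine Prod.ext rfl ?_
  simp only [shift_mul, SemidirectProduct.mul_right, Equiv.Perm.mul_apply,
    Equiv.symm_apply_apply, add_mul, Finset.sum_add_distrib]
  rw [← Equiv.sum_comp w.right (fun j => shift v (v.right j) * a.1 (w.right.symm j))]
  simp only [Equiv.symm_apply_apply]
  ring

@[simp] theorem actT_one (ξ : TPrime N) : actT 1 ξ = ξ := by
  rw [actT_eq]; refine Prod.ext rfl ?_; simp

@[simp] theorem actR_one (a : RootLattice N) : actR 1 a = a := by
  rw [actR_eq]; refine Prod.ext rfl ?_; simp

@[simp] theorem actT_inv_actT (w : AffW N) (ξ : TPrime N) : actT w⁻¹ (actT w ξ) = ξ := by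
  rw [← actT_mul, inv_mul_cancel, actT_one]

@[simp] theorem actT_actT_inv (w : AffW N) (ξ : TPrime N) : actT w (actT w⁻¹ ξ) = ξ := by
  rw [← actT_mul, mul_inv_cancel, actT_one]

@[simp] theorem actR_inv_actR (w : AffW N) (a : RootLattice N) : actR w⁻¹ (actR w a) = a := by
  rw [← actR_mul, inv_mul_cancel, actR_one]

@[simp] theorem actR_actR_inv (w : AffW N) (a : RootLattice N) : actR w (actR w⁻¹ a) = a := by
  rw [← actR_mul, mul_inv_cancel, actR_one]

theorem actT_add (w : AffW N) (ξ η : TPrime N) : actT w (ξ + η) = actT w ξ + actT w η := by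
  simp only [actT_eq]
  refine Prod.ext rfl ?_
  simp only [Prod.fst_add, Prod.snd_add, Pi.add_apply, mul_add, Finset.sum_add_distrib]
  ring

theorem actT_smul (w : AffW N) (c : ℂ) (ξ : TPrime N) : actT w (c • ξ) = c • actT w ξ := by
  simp only [actT_eq]
  refine Prod.ext rfl ?_
  simp only [Prod.smul_fst, Prod.smul_snd, Pi.smul_apply, smul_eq_mul, mul_sub, Finset.mul_sum]
  congr 1
  exact Finset.sum_congr rfl fun j _ => by ring

theorem actR_add (w : AffW N) (a b : RootLattice N) : actR w (a + b) = actR w a + actR w b := by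
  simp only [actR_eq]
  refine Prod.ext rfl ?_
  simp only [Prod.fst_add, Prod.snd_add, Pi.add_apply, mul_add, Finset.sum_add_distrib]
  ring

/-- The action on the root lattice by additive maps. -/
def actRHom (w : AffW N) : RootLattice N →+ RootLattice N :=
  AddMonoidHom.mk' (actR w) (actR_add w)

theorem actR_neg (w : AffW N) (a : RootLattice N) : actR w (-a) = -actR w a :=
  map_neg (actRHom w) a

theorem actR_sum (w : AffW N) {ι : Type*} (s : Finset ι) (f : ι → RootLattice N) :
    actR w (∑ i ∈ s, f i) = ∑ i ∈ s, actR w (f i) :=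
  map_sum (actRHom w) f s

theorem coroot_actR (w : AffW N) (a : RootLattice N) :
    coroot (actR w a) = actT w (coroot a) := by
  simp only [actT_eq, actR_eq]
  refine Prod.ext rfl ?_
  simp [coroot]

theorem coroot_neg (a : RootLattice N) : coroot (-a) = -coroot a := by
  refine Prod.ext (funext fun j => ?_) ?_ <;> simp [coroot]

theorem coroot_add (a b : RootLattice N) : coroot (a + b) = coroot a + coroot b := by
  refine Prod.ext (funext fun j => ?_) ?_ <;> simp [coroot]

theorem rootEval_actR (w : AffW N) (a : RootLattice N) (ξ : TPrime N) :
    rootEval (actR w a) (actT w ξ) = rootEval a ξ := by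
  simp only [rootEval, actT_eq, actR_eq]
  exact Equiv.sum_comp w.right.symm (fun j => (a.1 j : ℂ) * ξ.1 j)

theorem rootEval_neg (a : RootLattice N) (ξ : TPrime N) : rootEval (-a) ξ = -rootEval a ξ := by
  simp [rootEval]

theorem rootEval_add_right (a : RootLattice N) (ξ η : TPrime N) :
    rootEval a (ξ + η) = rootEval a ξ + rootEval a η := by
  simp [rootEval, mul_add, Finset.sum_add_distrib]

theorem rootEval_smul_right (a : RootLattice N) (c : ℂ) (ξ : TPrime N) :
    rootEval a (c • ξ) = c * rootEval a ξ := by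
  simp only [rootEval, Finset.mul_sum, Prod.smul_fst, Pi.smul_apply, smul_eq_mul]
  exact Finset.sum_congr rfl fun j _ => by ring

theorem actR_root (w : AffW N) (i j : Fin N) (k : ℤ) :
    actR w (root i j k) =
      root (w.right i) (w.right j) (k - shift w (w.right i) + shift w (w.right j)) := by
  rw [actR_eq]
  refine Prod.ext (funext fun l => ?_) ?_
  · simp [root, eps, Pi.single_apply, Equiv.symm_apply_eq]
  · simp [root, eps, Pi.single_apply, mul_sub, Finset.sum_sub_distrib]
    ring

theorem neg_root (i j : Fin N) (k : ℤ) : -root i j k = root j i (-k) := by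
  refine Prod.ext ?_ rfl
  simp [root]

theorem rootEval_root (i j : Fin N) (k : ℤ) (ξ : TPrime N) :
    rootEval (root i j k) ξ = ξ.1 i - ξ.1 j := by
  simp [rootEval, root, eps, Pi.single_apply, sub_mul, Finset.sum_sub_distrib]

theorem root_injective {i j i' j' : Fin N} {k k' : ℤ} (hij : i ≠ j)
    (h : root i j k = root i' j' k') : i = i' ∧ j = j' ∧ k = k' := by
  have h₁ := fun l => congrFun (congrArg Prod.fst h) l
  have h₂ : k = k' := congrArg Prod.snd h
  have hi := h₁ i
  have hj := h₁ j
  simp only [root, eps, Pi.sub_apply, Pi.single_apply, if_true, hij, hij.symm, if_false] at hi hj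
  refine ⟨?_, ?_, h₂⟩
  · by_contra hne
    rw [if_neg hne] at hi
    split_ifs at hi <;> omega
  · by_contra hne
    rw [if_neg hne] at hj
    split_ifs at hj <;> omega

theorem actR_mem_roots {w : AffW N} {a : RootLattice N} (h : a ∈ roots N) :
    actR w a ∈ roots N := by
  obtain ⟨i, j, k, hij, rfl⟩ := h
  exact ⟨_, _, _, w.right.injective.ne hij, actR_root w i j k⟩

theorem neg_mem_roots {a : RootLattice N} (h : a ∈ roots N) : -a ∈ roots N := by
  obtain ⟨i, j, k, hij, rfl⟩ := h
  exact ⟨j, i, -k, hij.symm, neg_root i j k⟩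

/-! ### Heights -/

/-- The height of a vector of the root lattice; simple roots have height one. -/
def ht : RootLattice N →+ ℤ :=
  AddMonoidHom.mk' (fun a => N * a.2 - ∑ j : Fin N, (j : ℤ) * a.1 j) fun a b => by
    simp only [Prod.snd_add, Prod.fst_add, Pi.add_apply, mul_add, Finset.sum_add_distrib]
    ring

theorem ht_apply (a : RootLattice N) : ht a = N * a.2 - ∑ j : Fin N, (j : ℤ) * a.1 j := rfl

theorem ht_root (i j : Fin N) (k : ℤ) : ht (root i j k) = N * k + j - i := by
  simp [ht_apply, root, eps, Pi.single_apply, mul_sub, Finset.sum_sub_distrib]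
  ring

/-- Since `|j - i| < N`, vanishing of `N k + j - i` forces `k = 0` and then `i = j`. -/
theorem ht_ne_zero {a : RootLattice N} (h : a ∈ roots N) : ht a ≠ 0 := by
  obtain ⟨i, j, k, hij, rfl⟩ := h
  rw [ht_root]
  intro h
  have hi := i.isLt
  have hj := j.isLt
  rcases lt_trichotomy k 0 with hk | rfl | hk
  · nlinarith
  · exact hij (Fin.ext (by omega))
  · nlinarith

/-- In `N k + j - i` the sign of `k` decides unless `k = 0`, when that of `j - i` does. Positivity
thus becomes the sign of an additive function. -/
theorem mem_posRoots_iff {a : RootLattice N} : a ∈ posRoots N ↔ a ∈ roots N ∧ 0 < ht a := by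
  constructor
  · rintro (⟨i, j, k, hij, hk, rfl⟩ | ⟨i, j, k, hij, hk, rfl⟩)
    · refine ⟨⟨i, j, k, hij.ne, rfl⟩, ?_⟩
      rw [ht_root]
      have : (i : ℕ) < j := hij
      have : 0 ≤ (N : ℤ) * k := by positivity
      omega
    · refine ⟨⟨j, i, k, hij.ne', rfl⟩, ?_⟩
      rw [ht_root]
      have := i.isLt
      have := j.isLt
      have : (N : ℤ) * 1 ≤ (N : ℤ) * k := by gcongr; omega
      omega
  · rintro ⟨⟨i, j, k, hij, rfl⟩, h⟩
    rw [ht_root] at h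
    have hi := i.isLt
    have hj := j.isLt
    rcases lt_trichotomy k 0 with hk | rfl | hk
    · nlinarith
    · exact Or.inl ⟨i, j, 0, by rw [Fin.lt_def]; omega, le_rfl, rfl⟩
    · rcases hij.lt_or_gt with hlt | hlt
      · exact Or.inl ⟨i, j, k, hlt, hk.le, rfl⟩
      · exact Or.inr ⟨j, i, k, hlt, hk, rfl⟩

theorem mem_inversions_iff {w : AffW N} {a : RootLattice N} :
    a ∈ inversions w ↔ a ∈ roots N ∧ 0 < ht a ∧ ht (actR w a) < 0 := by
  simp only [inversions, Set.mem_ofPred_eq, Set.mem_sdiff, mem_posRoots_iff]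
  constructor
  · rintro ⟨⟨h₁, h₂⟩, h₃, h₄⟩
    have := ht_ne_zero h₃
    exact ⟨h₁, h₂, lt_of_le_of_ne (not_lt.1 fun h => h₄ ⟨h₃, h⟩) this⟩
  · rintro ⟨h₁, h₂, h₃⟩
    exact ⟨⟨h₁, h₂⟩, actR_mem_roots h₁, fun h => by omega⟩

/-- A positive height forces `k ≥ 0`, and a negative height of the image bounds `k` by the shifts.
Finiteness is what makes `length` meaningful, as `Set.ncard` is zero on infinite sets. -/
theorem inversions_finite (w : AffW N) : (inversions w).Finite := by
  set B : ℤ := ∑ j, |shift w j| with hB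
  have hb : ∀ j, |shift w j| ≤ B := fun j =>
    Finset.single_le_sum (f := fun j => |shift w j|) (fun _ _ => abs_nonneg _) (Finset.mem_univ j)
  refine ((Set.finite_univ.prod (Set.finite_univ.prod (Set.finite_Icc 0 (2 * B)))).image
    fun x : Fin N × Fin N × ℤ => root x.1 x.2.1 x.2.2).subset ?_
  intro a ha
  obtain ⟨⟨i, j, k, hij, rfl⟩, h₁, h₂⟩ := mem_inversions_iff.1 ha
  refine ⟨(i, j, k), ⟨trivial, trivial, ?_⟩, rfl⟩
  rw [actR_root, ht_root] at h₂
  rw [ht_root] at h₁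
  have hi := i.isLt
  have hj := j.isLt
  have hi' := (w.right i).isLt
  have hj' := (w.right j).isLt
  have h₃ := abs_le.1 (hb (w.right i))
  have h₄ := abs_le.1 (hb (w.right j))
  constructor
  · change 0 ≤ k
    by_contra hk
    nlinarith
  · change k ≤ 2 * B
    by_contra hk
    have : 1 ≤ k - shift w (w.right i) + shift w (w.right j) := by omega
    nlinarith

end Actions

/-! ### Simple reflections -/

section Simple

variable {N : ℕ} [NeZero N]

theorem val_sub_one (i : Fin N) : ((i - 1 : Fin N) : ℤ) = i - 1 + (if i = 0 then (N : ℤ) else 0) := by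
  obtain ⟨n, rfl⟩ := Nat.exists_eq_succ_of_ne_zero (NeZero.ne N)
  split_ifs with h
  · subst h
    simp
  · have : 0 < (i : ℕ) := Nat.pos_of_ne_zero fun h' => h (Fin.ext h')
    rw [Fin.val_sub_one_of_ne_zero h]
    omega

theorem ht_simpleRoot (i : Fin N) : ht (simpleRoot i) = 1 := by
  rw [simpleRoot, ht_root, val_sub_one]
  split_ifs <;> ring

theorem sub_one_ne_self (hN : 1 < N) (i : Fin N) : i - 1 ≠ i := by
  intro h
  have := congrArg (fun j : Fin N => (j : ℤ)) h
  simp only [val_sub_one] at this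
  split_ifs at this <;> omega

theorem simpleRoot_mem_roots (hN : 1 < N) (i : Fin N) : simpleRoot i ∈ roots N :=
  ⟨_, _, _, sub_one_ne_self hN i, rfl⟩

theorem shift_simpleRefl (i j : Fin N) :
    shift (simpleRefl i) j = -(simpleRoot i).2 * (simpleRoot i).1 j := by
  rw [simpleRefl, shift_mul, shift_fin, add_zero]
  simp only [shift, transl, simpleRoot, root, SemidirectProduct.left_inl, toAdd_ofAdd]
  rfl

@[simp] theorem simpleRefl_right (i : Fin N) :
    (simpleRefl i).right = Equiv.swap (i - 1) i := by
  simp [simpleRefl, transl]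

/-- A transposition acts on coordinates by the reflection formula. The case `p = q` is allowed, so
`N = 1` needs no separate treatment. -/
theorem apply_swap_sub {R : Type*} [Ring R] {ι : Type*} [DecidableEq ι] (f : ι → R) (p q j : ι) :
    f (Equiv.swap p q j) =
      f j - (f p - f q) * (((Pi.single p 1 - Pi.single q 1 : ι → ℤ) j : ℤ) : R) := by
  by_cases hp : j = p
  · subst hp
    by_cases hq : j = q <;> simp [hq]
  · by_cases hq : j = q
    · subst hq
      simp [hp]
    · simp [Equiv.swap_apply_of_ne_of_ne hp hq, hp, hq]

theorem sum_swap_single {R : Type*} [CommRing R] {ι : Type*} [DecidableEq ι] [Fintype ι]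
    (f : ι → R) (p q : ι) :
    ∑ j, (((Pi.single p 1 - Pi.single q 1 : ι → ℤ) (Equiv.swap p q j) : ℤ) : R) * f j =
      -(f p - f q) := by
  rw [← Equiv.sum_comp (Equiv.swap p q)]
  simp [Pi.single_apply, sub_mul, Finset.sum_sub_distrib]

theorem actT_simpleRefl (i : Fin N) (ξ : TPrime N) :
    actT (simpleRefl i) ξ = ξ - rootEval (simpleRoot i) ξ • coroot (simpleRoot i) := by
  have hs := sum_swap_single ξ.1 (i - 1) i
  rw [actT_eq]
  simp only [shift_simpleRefl, simpleRefl_right, Equiv.symm_swap]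
  refine Prod.ext (funext fun j => ?_) ?_
  · simp only [simpleRoot, rootEval_root]
    exact apply_swap_sub ξ.1 _ _ j
  · simp only [simpleRoot, rootEval_root, Prod.snd_sub, Prod.smul_snd, smul_eq_mul]
    simp only [root, eps, coroot, neg_mul, Int.cast_neg, Int.cast_mul, mul_assoc,
      Finset.sum_neg_distrib, ← Finset.mul_sum, hs]
    ring

theorem actR_simpleRefl (i : Fin N) (a : RootLattice N) :
    actR (simpleRefl i) a = a - (a.1 (i - 1) - a.1 i) • simpleRoot i := by
  have hs := sum_swap_single a.1 (i - 1) i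
  rw [actR_eq]
  simp only [shift_simpleRefl, simpleRefl_right, Equiv.symm_swap]
  refine Prod.ext (funext fun j => ?_) ?_
  · exact (apply_swap_sub a.1 _ _ j).trans (by simp [simpleRoot, root, eps])
  · simp only [simpleRoot, Prod.snd_sub, Prod.smul_snd, smul_eq_mul]
    simp only [Int.cast_id] at hs
    simp only [root, eps, neg_mul, mul_assoc,
      Finset.sum_neg_distrib, ← Finset.mul_sum, hs]
    ring

theorem actR_simpleRefl_self (hN : 1 < N) (i : Fin N) :
    actR (simpleRefl i) (simpleRoot i) = -simpleRoot i := by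
  have h := sub_one_ne_self hN i
  have : (simpleRoot i).1 (i - 1) - (simpleRoot i).1 i = 2 := by
    simp [simpleRoot, root, eps, h, h.symm]
  rw [actR_simpleRefl, this]
  module

@[simp] theorem simpleRefl_mul_self (i : Fin N) : simpleRefl i * simpleRefl i = 1 := by
  refine affW_ext ?_ fun j => ?_
  · simp
  · rw [shift_mul, shift_simpleRefl, shift_simpleRefl, simpleRefl_right, Equiv.symm_swap, shift_one]
    have := apply_swap_sub (simpleRoot i).1 (i - 1) i j
    rw [this]
    by_cases h : i - 1 = i
    · simp [simpleRoot, root, h]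
    · have : (simpleRoot i).1 (i - 1) - (simpleRoot i).1 i = 2 := by
        simp [simpleRoot, root, eps, h, Ne.symm h]
      rw [this]
      simp only [simpleRoot, root, eps, Int.cast_id]
      ring

@[simp] theorem simpleRefl_inv (i : Fin N) : (simpleRefl i)⁻¹ = simpleRefl i :=
  inv_eq_of_mul_eq_one_left (simpleRefl_mul_self i)

@[simp] theorem simpleRefl_mul_cancel_left (i : Fin N) (w : AffW N) :
    simpleRefl i * (simpleRefl i * w) = w := by
  rw [← mul_assoc, simpleRefl_mul_self, one_mul]

@[simp] theorem actR_simpleRefl_simpleRefl (i : Fin N) (a : RootLattice N) :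
    actR (simpleRefl i) (actR (simpleRefl i) a) = a := by
  rw [← actR_mul, simpleRefl_mul_self, actR_one]

@[simp] theorem actT_simpleRefl_simpleRefl (i : Fin N) (ξ : TPrime N) :
    actT (simpleRefl i) (actT (simpleRefl i) ξ) = ξ := by
  rw [← actT_mul, simpleRefl_mul_self, actT_one]

/-- A simple reflection permutes the positive roots other than the simple root. -/
theorem ht_actR_simpleRefl_pos {i : Fin N} {a : RootLattice N} (ha : a ∈ roots N) (h : 0 < ht a)
    (hne : a ≠ simpleRoot i) : 0 < ht (actR (simpleRefl i) a) := by
  by_contra hneg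
  have h₀ := ht_ne_zero (actR_mem_roots (w := simpleRefl i) ha)
  rw [actR_simpleRefl, map_sub, map_zsmul, ht_simpleRoot] at hneg h₀
  obtain ⟨p, q, k, hpq, rfl⟩ := ha
  apply hne
  simp only [smul_eq_mul, mul_one] at hneg h₀
  -- The reflection lowers the height by this pairing, which is at most 2. Going from positive to
  -- negative therefore needs pairing 2 and height 1, which forces the root to be `simpleRoot i`.
  have e : (root p q k).1 (i - 1) - (root p q k).1 i = (if i - 1 = p then 1 else 0) -
      (if i - 1 = q then 1 else 0) - ((if i = p then 1 else 0) - (if i = q then 1 else 0)) := by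
    simp [root, eps, Pi.single_apply]
  rw [e] at hneg h₀
  have hp : i - 1 = p := by
    by_contra hp
    rw [if_neg hp] at hneg h₀
    split_ifs at hneg h₀ <;> omega
  have hq : i = q := by
    by_contra hq
    rw [if_neg hq] at hneg h₀
    split_ifs at hneg h₀ <;> omega
  have h₁ : ht (root p q k) = 1 := by
    split_ifs at hneg h₀ <;> omega
  subst hp hq
  have h₂ := ht_simpleRoot i
  rw [simpleRoot, ht_root] at h₂
  rw [ht_root] at h₁
  have : (N : ℤ) * k = N * (if i = 0 then 1 else 0) := by omega
  rw [simpleRoot, mul_left_cancel₀ (Nat.cast_ne_zero.2 (NeZero.ne N)) this]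

/-! ### Lengths -/

/-- The only positive root made negative by `s_i` is `α_i`, so the inversions of `w` persist and the
only new one is the root that `w` sends to `α_i`. -/
theorem inversions_simpleRefl_mul (hN : 1 < N) {i : Fin N} {w : AffW N}
    (h : 0 < ht (actR w⁻¹ (simpleRoot i))) :
    inversions (simpleRefl i * w) = insert (actR w⁻¹ (simpleRoot i)) (inversions w) := by
  ext a
  rw [Set.mem_insert_iff, mem_inversions_iff, mem_inversions_iff, actR_mul]
  constructor
  · rintro ⟨h₁, h₂, h₃⟩
    by_cases hw : ht (actR w a) < 0
    · exact Or.inr ⟨h₁, h₂, hw⟩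
    · left
      have hr := actR_mem_roots (w := w) h₁
      have := ht_ne_zero hr
      have hs : actR w a = simpleRoot i := by
        by_contra hne
        have := ht_actR_simpleRefl_pos hr (by omega) hne
        omega
      rw [← hs, actR_inv_actR]
  · rintro (rfl | ⟨h₁, h₂, h₃⟩)
    · refine ⟨actR_mem_roots (simpleRoot_mem_roots hN i), h, ?_⟩
      rw [actR_actR_inv, actR_simpleRefl_self hN, map_neg, ht_simpleRoot]
      omega
    · refine ⟨h₁, h₂, ?_⟩
      have hr := neg_mem_roots (actR_mem_roots (w := w) h₁)
      have hne : -actR w a ≠ simpleRoot i := by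
        intro he
        rw [← he, actR_neg, actR_inv_actR, map_neg] at h
        omega
      have := ht_actR_simpleRefl_pos hr (by rw [map_neg]; omega) hne
      rw [actR_neg, map_neg] at this
      omega

theorem length_simpleRefl_mul (hN : 1 < N) {i : Fin N} {w : AffW N}
    (h : 0 < ht (actR w⁻¹ (simpleRoot i))) : length (simpleRefl i * w) = length w + 1 := by
  rw [length, inversions_simpleRefl_mul hN h, Set.ncard_insert_of_notMem _ (inversions_finite w),
    length]
  intro hm
  have := (mem_inversions_iff.1 hm).2.2
  rw [actR_actR_inv, ht_simpleRoot] at this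
  omega

theorem length_simpleRefl_mul_of_neg (hN : 1 < N) {i : Fin N} {w : AffW N}
    (h : ht (actR w⁻¹ (simpleRoot i)) < 0) : length w = length (simpleRefl i * w) + 1 := by
  have := length_simpleRefl_mul (w := simpleRefl i * w) hN (i := i) (by
    rw [mul_inv_rev, actR_mul, simpleRefl_inv, actR_simpleRefl_self hN, actR_neg, map_neg]
    omega)
  rwa [simpleRefl_mul_cancel_left] at this

theorem one_lt_or_eq_one : 1 < N ∨ N = 1 := by
  have := NeZero.ne N
  omega

/-- For `N = 1` the vector `simpleRoot i` is `δ`, which is not a root. This degenerate case is the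
reason for the hypotheses `1 < N`. -/
theorem simpleRefl_eq_one (hN : N = 1) (i : Fin N) : simpleRefl i = 1 := by
  subst hN
  refine affW_ext (Subsingleton.elim _ _) fun j => ?_
  rw [shift_simpleRefl, simpleRoot, Subsingleton.elim (i - 1) i]
  simp [root]

theorem length_simpleRefl_mul_le (i : Fin N) (w : AffW N) :
    length (simpleRefl i * w) ≤ length w + 1 := by
  rcases one_lt_or_eq_one (N := N) with hN | hN
  · rcases (ht_ne_zero (actR_mem_roots (w := w⁻¹) (simpleRoot_mem_roots hN i))).lt_or_gt with h | h
    · have := length_simpleRefl_mul_of_neg hN h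
      omega
    · exact (length_simpleRefl_mul hN h).le
  · rw [simpleRefl_eq_one hN, one_mul]
    omega

theorem inversions_of_length_eq {i : Fin N} {w : AffW N}
    (h : length (simpleRefl i * w) = length w + 1) :
    inversions (simpleRefl i * w) = insert (actR w⁻¹ (simpleRoot i)) (inversions w) := by
  rcases one_lt_or_eq_one (N := N) with hN | hN
  · apply inversions_simpleRefl_mul hN
    rcases (ht_ne_zero (actR_mem_roots (w := w⁻¹) (simpleRoot_mem_roots hN i))).lt_or_gt with h' | h'
    · have := length_simpleRefl_mul_of_neg hN h'
      omega
    · exact h'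
  · rw [simpleRefl_eq_one hN, one_mul] at h
    omega

/-- A right descent shortens. -/
theorem length_mul_simpleRefl_lt (hN : 1 < N) {i : Fin N} {w : AffW N}
    (h : ht (actR w (simpleRoot i)) < 0) : length (w * simpleRefl i) < length w := by
  have hmem : simpleRoot i ∈ inversions w :=
    mem_inversions_iff.2 ⟨simpleRoot_mem_roots hN i, by rw [ht_simpleRoot]; omega, h⟩
  -- `s_i` permutes the positive roots other than `α_i`, so it carries `S(w s_i)` into `S(w)`
  -- without `α_i`.
  have hsub : inversions (w * simpleRefl i) ⊆
      actR (simpleRefl i) '' (inversions w \ {simpleRoot i}) := by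
    intro a ha
    obtain ⟨h₁, h₂, h₃⟩ := mem_inversions_iff.1 ha
    rw [actR_mul] at h₃
    have hne : a ≠ simpleRoot i := by
      rintro rfl
      rw [actR_simpleRefl_self hN, actR_neg, map_neg] at h₃
      omega
    refine ⟨actR (simpleRefl i) a, ⟨mem_inversions_iff.2 ⟨actR_mem_roots h₁,
      ht_actR_simpleRefl_pos h₁ h₂ hne, h₃⟩, ?_⟩, actR_simpleRefl_simpleRefl i a⟩
    rintro (he : _ = _)
    rw [← actR_simpleRefl_simpleRefl i a, he, actR_simpleRefl_self hN, map_neg,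
      ht_simpleRoot] at h₂
    omega
  have hfin := (inversions_finite w).sdiff (t := {simpleRoot i})
  calc length (w * simpleRefl i) ≤ (inversions w \ {simpleRoot i}).ncard :=
        (Set.ncard_le_ncard hsub (hfin.image _)).trans (Set.ncard_image_le hfin)
    _ < length w := Set.ncard_sdiff_singleton_lt_of_mem hmem (inversions_finite w)

end Simple

/-! ### Heights of images, and inversions of finite permutations -/

section Affine

variable {N : ℕ}

theorem ht_actR (w : AffW N) (a : RootLattice N) :
    ht (actR w a) = N * a.2 - ∑ j, (N * shift w (w.right j) + (w.right j : ℤ)) * a.1 j := by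
  rw [ht_apply, actR_eq]
  simp only [add_mul, Finset.sum_add_distrib, mul_sub, Finset.mul_sum, mul_assoc]
  rw [← Equiv.sum_comp w.right (fun j : Fin N => (j : ℤ) * a.1 (w.right.symm j))]
  simp only [Equiv.symm_apply_apply]
  ring

theorem sum_actR (w : AffW N) (a : RootLattice N) : ∑ j, (actR w a).1 j = ∑ j, a.1 j :=
  Equiv.sum_comp w.right.symm a.1

theorem sum_root (i j : Fin N) (k : ℤ) : ∑ l, (root i j k).1 l = 0 := by
  simp [root, eps, Finset.sum_sub_distrib]

theorem inversions_one : inversions (1 : AffW N) = ∅ := by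
  ext a
  simp only [mem_inversions_iff, actR_one, Set.mem_empty_iff_false, iff_false]
  rintro ⟨_, h₁, h₂⟩
  omega

theorem length_one : length (1 : AffW N) = 0 := by
  rw [length, inversions_one, Set.ncard_empty]

/-- The height of `w(ε_p)` is `-(N * shift + w.right p)`; division with remainder by `N` recovers
both the translation and the permutation. -/
theorem eq_of_ht_actR_eq {v w : AffW N}
    (h : ∀ p, ht (actR v (eps p, 0)) = ht (actR w (eps p, 0))) : v = w := by
  have key : ∀ p, v.right p = w.right p ∧ shift v (v.right p) = shift w (w.right p) := by
    intro p
    have hp := h p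
    simp only [ht_actR, eps, Pi.single_apply, mul_ite, mul_one, mul_zero, Finset.sum_ite_eq',
      Finset.mem_univ, if_true] at hp
    have h₁ := (v.right p).isLt
    have h₂ := (w.right p).isLt
    have h₃ : shift v (v.right p) = shift w (w.right p) := by
      rcases lt_trichotomy (shift v (v.right p)) (shift w (w.right p)) with h' | h' | h'
      · nlinarith
      · exact h'
      · nlinarith
    rw [h₃] at hp
    exact ⟨Fin.ext (by omega), h₃⟩
  have hr : v.right = w.right := Equiv.ext fun p => (key p).1
  refine affW_ext hr fun j => ?_
  have := (key (v.right.symm j)).2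
  rwa [← hr, Equiv.apply_symm_apply] at this

theorem root_eq_sub (i j : Fin N) : root i j 0 = ((eps i, 0) : RootLattice N) - (eps j, 0) := by
  refine Prod.ext rfl ?_
  simp [root]

theorem actR_fin_snd (σ : Equiv.Perm (Fin N)) (a : RootLattice N) :
    (actR (fin σ) a).2 = a.2 := by
  simp [actR_eq]

/-- A finite permutation keeps the coefficient of `δ`, and a root with positive coefficient has
positive height; hence an inverted root has coefficient zero. -/
theorem inversions_fin_subset (σ : Equiv.Perm (Fin N)) :
    inversions (fin σ) ⊆ finPosRoots N := by
  intro a ha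
  obtain ⟨⟨i, j, k, hij, rfl⟩, h₁, h₂⟩ := mem_inversions_iff.1 ha
  rw [ht_root] at h₁
  rw [actR_root, ht_root] at h₂
  simp only [fin_right, shift_fin, sub_zero, add_zero] at h₂
  have := i.isLt
  have := j.isLt
  have := (σ i).isLt
  have := (σ j).isLt
  rcases lt_trichotomy k 0 with hk | rfl | hk
  · nlinarith
  · exact ⟨i, j, by rw [Fin.lt_def]; omega, rfl⟩
  · nlinarith

end Affine

/-! ### The element `π` and reduced expressions -/

section Reduced

variable {N : ℕ} [NeZero N]

@[simp] theorem piElt_right : (piElt N).right = finRotate N := by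
  simp [piElt, transl]

theorem shift_piElt (j : Fin N) : shift (piElt N) j = (eps 0 : Fin N → ℤ) j := by
  rw [piElt, shift_mul, shift_fin, add_zero]
  rfl

/-- `π` lowers the height of every `ε_j` by one, the wrap-around being compensated by `δ`. Roots
have coordinate sum zero, so their heights are unchanged and `π` has length zero. -/
theorem ht_actR_piElt (a : RootLattice N) : ht (actR (piElt N) a) = ht a - ∑ j, a.1 j := by
  rw [ht_actR, ht_apply, sub_sub, ← Finset.sum_add_distrib]
  congr 1
  refine Finset.sum_congr rfl fun j _ => ?_
  have h := val_sub_one (finRotate N j)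
  rw [show finRotate N j - 1 = j by rw [finRotate_apply]; exact add_sub_cancel_right j 1] at h
  rw [piElt_right, shift_piElt, h]
  simp only [eps, Pi.single_apply]
  split_ifs <;> ring

theorem ht_actR_piElt_zpow (k : ℤ) (a : RootLattice N) :
    ht (actR (piElt N ^ k) a) = ht a - k * ∑ j, a.1 j := by
  induction k using Int.induction_on generalizing a with
  | zero => simp
  | succ n ih =>
    rw [zpow_add_one, actR_mul, ih, ht_actR_piElt, sum_actR]
    ring
  | pred n ih =>
    have h := ht_actR_piElt (actR (piElt N)⁻¹ a)
    rw [actR_actR_inv, sum_actR] at h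
    rw [zpow_sub_one, actR_mul, ih, sum_actR]
    linarith

theorem inversions_piElt_zpow_mul (k : ℤ) (w : AffW N) :
    inversions (piElt N ^ k * w) = inversions w := by
  ext a
  simp only [mem_inversions_iff, actR_mul, ht_actR_piElt_zpow, sum_actR]
  constructor <;>
  · rintro ⟨⟨i, j, k, hij, rfl⟩, h₁, h₂⟩
    rw [sum_root] at *
    exact ⟨⟨i, j, k, hij, rfl⟩, h₁, by linarith⟩

theorem length_piElt_zpow_mul (k : ℤ) (w : AffW N) : length (piElt N ^ k * w) = length w := by
  rw [length, inversions_piElt_zpow_mul, length]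

theorem simpleRoot_of_ne_zero {i : Fin N} (h : i ≠ 0) : simpleRoot i = root (i - 1) i 0 := by
  rw [simpleRoot, if_neg h]

theorem sum_simpleRoot : ∑ i : Fin N, simpleRoot i = (0, 1) := by
  refine Prod.ext ?_ ?_
  · simp only [simpleRoot, root, Prod.fst_sum, Finset.sum_sub_distrib]
    rw [sub_eq_zero]
    exact Equiv.sum_comp (Equiv.subRight (1 : Fin N)) eps
  · simp [simpleRoot, root, Prod.snd_sum]

/-- Elements without right descents are powers of `π`. -/
theorem eq_piElt_zpow {w : AffW N} (h : ∀ i, 0 < ht (actR w (simpleRoot i))) :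
    ∃ k : ℤ, w = piElt N ^ k := by
  -- The simple roots sum to `δ`, which is fixed and has height `N`; `N` positive integers with sum
  -- `N` all equal one.
  have hsum : ∑ i, ht (actR w (simpleRoot i)) = N := by
    rw [← map_sum, ← actR_sum, sum_simpleRoot, ht_actR]
    simp
  have h₁ : ∀ i, ht (actR w (simpleRoot i)) = 1 := by
    have := (Finset.sum_eq_sum_iff_of_le (s := Finset.univ) (f := fun _ : Fin N => (1 : ℤ))
      (g := fun i => ht (actR w (simpleRoot i))) fun i _ => h i).1 (by simp [hsum])
    exact fun i => (this i (Finset.mem_univ i)).symm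
  -- `eps 0` has height zero and `π ^ k` lowers it by `k`, which dictates the exponent.
  refine ⟨-ht (actR w (eps 0, 0)), eq_of_ht_actR_eq fun p => ?_⟩
  rw [ht_actR_piElt_zpow]
  have hp : ∀ n : ℕ, ∀ hn : n < N,
      ht (actR w (eps ⟨n, hn⟩, 0)) = ht (actR w (eps 0, 0)) - n := by
    intro n
    induction n with
    | zero => intro hn; simp
    | succ n ih =>
      intro hn
      have hne : (⟨n + 1, hn⟩ : Fin N) ≠ 0 := fun h => by simpa using congrArg Fin.val h
      have hs : (⟨n + 1, hn⟩ : Fin N) - 1 = ⟨n, by omega⟩ := by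
        have := val_sub_one (⟨n + 1, hn⟩ : Fin N)
        rw [if_neg hne] at this
        exact Fin.ext (by simpa using this)
      have := h₁ ⟨n + 1, hn⟩
      rw [simpleRoot_of_ne_zero hne, root_eq_sub, hs, sub_eq_add_neg, actR_add, actR_neg,
        map_add, map_neg, ih] at this
      push_cast
      linarith
  have h₂ : ht ((eps p, 0) : RootLattice N) = -p := by simp [ht_apply, eps, Pi.single_apply]
  have h₃ : ∑ j, (eps p : Fin N → ℤ) j = 1 := by simp [eps]
  have h₄ := hp p.1 p.2
  simp only [Fin.eta] at h₄
  rw [h₂, h₃, h₄]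
  ring

theorem length_prod_le (js : List (Fin N)) : length (js.map simpleRefl).prod ≤ js.length := by
  induction js with
  | nil => simp [length_one]
  | cons j js ih =>
    rw [List.map_cons, List.prod_cons, List.length_cons]
    have := length_simpleRefl_mul_le j (js.map simpleRefl).prod
    omega

theorem exists_isReducedExpr (w : AffW N) : ∃ e, IsReducedExpr w e := by
  suffices ∀ n, ∀ w : AffW N, length w = n → ∃ (k : ℤ) (js : List (Fin N)),
      w = piElt N ^ k * (js.map simpleRefl).prod ∧ js.length ≤ n by
    obtain ⟨k, js, h₁, h₂⟩ := this _ w rfl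
    refine ⟨(k, js), h₁, le_antisymm h₂ ?_⟩
    rw [h₁, length_piElt_zpow_mul]
    exact length_prod_le js
  intro n
  induction n using Nat.strong_induction_on with
  | _ n ih =>
    intro w hw
    by_cases h : ∀ i, 0 < ht (actR w (simpleRoot i))
    · obtain ⟨k, rfl⟩ := eq_piElt_zpow h
      exact ⟨k, [], by simp, by simp⟩
    · push Not at h
      obtain ⟨i, hi⟩ := h
      -- For `N = 1` the vector `simpleRoot i` is `δ`, whose height stays one, so no descent exists.
      have hN : 1 < N := by
        by_contra hN
        have hN : N = 1 := (one_lt_or_eq_one (N := N)).resolve_left hN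
        subst hN
        have : simpleRoot i = (0, 1) := by
          rw [simpleRoot, Subsingleton.elim (i - 1) i, if_pos (Subsingleton.elim _ _)]
          simp [root]
        rw [this, ht_actR] at hi
        simp at hi
      have hi' := lt_of_le_of_ne hi
        (ht_ne_zero (actR_mem_roots (simpleRoot_mem_roots hN i)))
      have hl := length_mul_simpleRefl_lt hN hi'
      obtain ⟨k, js, h₁, h₂⟩ := ih _ (hw ▸ hl) _ rfl
      refine ⟨k, js ++ [i], ?_, ?_⟩
      · rw [List.map_append, List.prod_append, ← mul_assoc, ← h₁, mul_assoc]
        simp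
      · simp only [List.length_append, List.length_singleton]
        omega

/-- `W` is generated by the `s_i` and `π`. This lets identities on `ℂ[W]` be checked one generator
at a time. -/
theorem affW_induction {P : AffW N → Prop} (one : P 1)
    (refl : ∀ i w, P w → P (simpleRefl i * w)) (pi : ∀ w, P w → P (piElt N * w))
    (pi_inv : ∀ w, P w → P ((piElt N)⁻¹ * w)) (w : AffW N) : P w := by
  obtain ⟨⟨k, js⟩, rfl, -⟩ := exists_isReducedExpr w
  have h : P (js.map simpleRefl).prod := by
    induction js with
    | nil => exact one
    | cons j js ih => simpa using refl j _ ih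
  generalize (js.map simpleRefl).prod = v at h
  dsimp only
  induction k using Int.induction_on generalizing v with
  | zero => simpa using h
  | succ n ih => rw [zpow_add_one, mul_assoc]; exact ih _ (pi _ h)
  | pred n ih => rw [zpow_sub_one, mul_assoc]; exact ih _ (pi_inv _ h)

/-- A word in the simple reflections is reduced. -/
def IsReducedWord (js : List (Fin N)) : Prop := length (js.map simpleRefl).prod = js.length

theorem IsReducedExpr.isReducedWord {w : AffW N} {e : ℤ × List (Fin N)}
    (h : IsReducedExpr w e) : IsReducedWord e.2 := by
  rw [IsReducedWord, h.2, h.1, length_piElt_zpow_mul]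

theorem IsReducedExpr.inversions_eq {w : AffW N} {e : ℤ × List (Fin N)}
    (h : IsReducedExpr w e) : inversions w = inversions (e.2.map simpleRefl).prod := by
  rw [h.1, inversions_piElt_zpow_mul]

theorem IsReducedWord.of_cons {j : Fin N} {js : List (Fin N)} (h : IsReducedWord (j :: js)) :
    IsReducedWord js := by
  have h₁ := length_simpleRefl_mul_le j (js.map simpleRefl).prod
  have h₂ := length_prod_le js
  rw [IsReducedWord, List.map_cons, List.prod_cons, List.length_cons] at h
  rw [IsReducedWord]
  omega

theorem IsReducedWord.inversions_cons {j : Fin N} {js : List (Fin N)}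
    (h : IsReducedWord (j :: js)) :
    inversions ((j :: js).map simpleRefl).prod =
      insert (actR ((js.map simpleRefl).prod)⁻¹ (simpleRoot j))
        (inversions (js.map simpleRefl).prod) := by
  have h' := h.of_cons
  rw [IsReducedWord] at h h'
  rw [List.map_cons, List.prod_cons] at h ⊢
  apply inversions_of_length_eq
  rw [h, h', List.length_cons]

/-! ### The finite Weyl group -/

theorem simpleRefl_of_ne_zero {i : Fin N} (h : i ≠ 0) :
    simpleRefl i = fin (Equiv.swap (i - 1) i) :=
  affW_ext (by simp) fun j => by simp [shift_simpleRefl, simpleRoot, root, h]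

/-- Each letter `j` adds the inversion `v⁻¹ α_j`, where `v` is the product of the letters to its
right. If `v` is finite, `j = 0` would add a root with `δ`-coefficient one, which is not a finite
root. -/
theorem isReducedWord_letters_ne_zero {js : List (Fin N)} (h : IsReducedWord js)
    (hinv : inversions (js.map simpleRefl).prod ⊆ finPosRoots N) :
    (∀ j ∈ js, j ≠ 0) ∧ ∃ σ, (js.map simpleRefl).prod = fin σ := by
  induction js with
  | nil => exact ⟨by simp, 1, rfl⟩
  | cons j js ih =>
    rw [h.inversions_cons] at hinv
    obtain ⟨h₁, σ, h₂⟩ := ih h.of_cons ((Set.subset_insert _ _).trans hinv)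
    have hj : j ≠ 0 := by
      rintro rfl
      obtain ⟨p, q, -, hpq⟩ := hinv (Set.mem_insert _ _)
      rw [h₂, ← fin_inv] at hpq
      have := congrArg Prod.snd hpq
      rw [actR_fin_snd] at this
      simp [simpleRoot, root] at this
    refine ⟨by simpa [hj] using h₁, Equiv.swap (j - 1) j * σ, ?_⟩
    rw [List.map_cons, List.prod_cons, h₂, simpleRefl_of_ne_zero hj, fin_mul]

/-- Reduced expressions of elements of the finite Weyl group stay in the finite Weyl group. -/
theorem IsReducedExpr.of_fin {σ : Equiv.Perm (Fin N)} {e : ℤ × List (Fin N)}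
    (h : IsReducedExpr (fin σ) e) : e.1 = 0 ∧ ∀ j ∈ e.2, j ≠ 0 := by
  obtain ⟨h₁, τ, h₂⟩ := isReducedWord_letters_ne_zero h.isReducedWord
    (h.inversions_eq ▸ inversions_fin_subset σ)
  refine ⟨?_, h₁⟩
  have h₃ : piElt N ^ e.1 = fin (σ * τ⁻¹) := by
    rw [fin_mul, fin_inv, h.1, h₂, mul_inv_cancel_right]
  -- Heights show that this finite permutation is a shift by the exponent of `π`; a shift preserving
  -- `0, …, N - 1` is trivial.
  have key : ∀ p : Fin N, (((σ * τ⁻¹) p : Fin N) : ℤ) = p + e.1 := by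
    intro p
    have := ht_actR_piElt_zpow e.1 ((eps p, 0) : RootLattice N)
    rw [h₃, ht_actR, ht_apply] at this
    simp only [fin_right, shift_fin, eps, Pi.single_apply, mul_ite, mul_one, mul_zero, zero_add,
      Finset.sum_ite_eq', Finset.mem_univ, if_true] at this
    linarith
  have h0 := key 0
  have hl := key ⟨N - 1, by have := NeZero.pos N; omega⟩
  have := ((σ * τ⁻¹) ⟨N - 1, by have := NeZero.pos N; omega⟩).isLt
  have := NeZero.pos N
  rw [Fin.val_zero] at h0
  dsimp only at hl
  omega

end Reduced

/-! ### Minimal coset representatives -/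

section Cosets

variable {N : ℕ} (β : Composition N)

theorem exists_mem_cosetReps (w : AffW N) :
    ∃ u ∈ parabolic β, w * fin u ∈ cosetReps β ∧ length (w * fin u) ≤ length w := by
  let f : parabolic β → ℕ := fun u => length (w * fin (u : Equiv.Perm (Fin N)))
  refine ⟨(Function.argmin f : parabolic β), (Function.argmin f).2, fun v hv => ?_, ?_⟩
  · have := Function.argmin_le f (Function.argmin f * ⟨v, hv⟩)
    rw [mul_assoc, ← fin_mul]
    exact this
  · have := Function.argmin_le f 1
    simpa [f] using this

variable {β}

theorem index_mono {i j : Fin N} (h : i ≤ j) : β.index i ≤ β.index j := by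
  by_contra hlt
  rw [not_le] at hlt
  have h₁ := β.lt_sizeUpTo_index_succ j
  have h₂ := β.sizeUpTo_index_le i
  have h₃ := β.monotone_sizeUpTo (show (β.index j).succ.val ≤ (β.index i).val by
    rw [Fin.val_succ]; exact hlt)
  have : (i : ℕ) ≤ j := h
  omega

theorem index_of_mem_parabolic {u : Equiv.Perm (Fin N)} (hu : u ∈ parabolic β) (i : Fin N) :
    β.index (u i) = β.index i := by
  induction hu using Subgroup.closure_induction generalizing i with
  | mem σ hσ =>
    obtain ⟨p, q, ⟨-, hpq⟩, rfl⟩ := hσ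
    rcases eq_or_ne i p with rfl | hp
    · rw [Equiv.swap_apply_left, hpq]
    · rcases eq_or_ne i q with rfl | hq
      · rw [Equiv.swap_apply_right, hpq]
      · rw [Equiv.swap_apply_of_ne_of_ne hp hq]
  | one => rfl
  | mul σ τ _ _ h₁ h₂ => rw [Equiv.Perm.mul_apply, h₁, h₂]
  | inv σ _ h => rw [← h, Equiv.Perm.coe_inv, Equiv.apply_symm_apply]

/-- A permutation that increases on all neighbours is strictly increasing and surjective, hence the
identity. -/
theorem exists_adjacent_descent {u : Equiv.Perm (Fin N)} (hu : u ≠ 1) :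
    ∃ i j : Fin N, (i : ℕ) + 1 = j ∧ u j < u i := by
  by_contra! h
  apply hu
  have hmono : StrictMono u := by
    obtain rfl | ⟨n, rfl⟩ : N = 0 ∨ ∃ n, N = n + 1 := by cases N <;> simp
    · exact fun i => i.elim0
    · refine Fin.strictMono_iff_lt_succ.2 fun i => ?_
      exact lt_of_le_of_ne (h _ _ (by simp)) (u.injective.ne Fin.castSucc_lt_succ.ne)
  exact Equiv.ext fun i => congrFun (hmono.range_inj strictMono_id |>.1 (by simp)) i

variable [NeZero N]

theorem IsBetaSimple.eq_sub_one {i j : Fin N} (h : IsBetaSimple β i j) : j ≠ 0 ∧ i = j - 1 := by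
  have hj : j ≠ 0 := by
    rintro rfl
    exact absurd h.1 (by simp)
  have := val_sub_one j
  rw [if_neg hj] at this
  have := h.1
  exact ⟨hj, Fin.ext (by omega)⟩

theorem IsBetaSimple.fin_swap {i j : Fin N} (h : IsBetaSimple β i j) :
    fin (Equiv.swap i j) = simpleRefl j := by
  obtain ⟨hj, rfl⟩ := h.eq_sub_one
  rw [simpleRefl_of_ne_zero hj]

omit [NeZero N] in
theorem IsBetaSimple.swap_mem_parabolic {i j : Fin N} (h : IsBetaSimple β i j) :
    Equiv.swap i j ∈ parabolic β :=
  Subgroup.subset_closure ⟨i, j, h, rfl⟩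

theorem ht_actR_simpleRoot_pos {w : AffW N} (hw : w ∈ cosetReps β) {j : Fin N}
    (hj : IsBetaSimple β (j - 1) j) : 0 < ht (actR w (simpleRoot j)) := by
  have hN : 1 < N := by
    have := hj.1
    omega
  by_contra hneg
  have h₁ := length_mul_simpleRefl_lt hN (lt_of_le_of_ne (not_lt.1 hneg)
    (ht_ne_zero (actR_mem_roots (simpleRoot_mem_roots hN j))))
  have h₂ := hw _ hj.swap_mem_parabolic
  rw [hj.fin_swap] at h₂
  omega

/-- The root is a sum of simple roots of `β`, and a minimal representative keeps each of these
positive because it has no descent there. -/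
theorem ht_pos_of_mem_cosetReps {w : AffW N} (hw : w ∈ cosetReps β) {i j : Fin N} (hij : i < j)
    (hβ : β.index i = β.index j) : 0 < ht (actR w (root i j 0)) := by
  obtain ⟨n, hn⟩ : ∃ n, (j : ℕ) = i + 1 + n := ⟨j - (i + 1), by
    have : (i : ℕ) < j := hij
    omega⟩
  induction n generalizing j with
  | zero =>
    have hb : IsBetaSimple β i j := ⟨by omega, hβ⟩
    obtain ⟨hj, rfl⟩ := hb.eq_sub_one
    rw [← simpleRoot_of_ne_zero hj]
    exact ht_actR_simpleRoot_pos hw hb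
  | succ n ih =>
    have hj : j ≠ 0 := by
      rintro rfl
      exact absurd hij (Fin.not_lt_zero i)
    have hs := val_sub_one j
    rw [if_neg hj] at hs
    have h₁ : i < j - 1 := by rw [Fin.lt_def]; omega
    have h₂ : β.index i = β.index (j - 1) := le_antisymm (index_mono h₁.le)
      (hβ ▸ index_mono (by rw [Fin.le_def]; omega))
    have h₃ := ih h₁ h₂ (by omega)
    have h₄ := ht_actR_simpleRoot_pos hw (j := j) ⟨by omega, h₂ ▸ hβ⟩
    have : root i j 0 = root i (j - 1) 0 + simpleRoot j := by
      rw [simpleRoot_of_ne_zero hj]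
      refine Prod.ext ?_ ?_ <;> simp [root]
    rw [this, actR_add, map_add]
    omega

/-- A coset of the parabolic subgroup contains only one minimal representative. -/
theorem cosetReps_unique {w : AffW N} {u : Equiv.Perm (Fin N)} (hw : w ∈ cosetReps β)
    (hu : u ∈ parabolic β) (hwu : w * fin u ∈ cosetReps β) : u = 1 := by
  by_contra hne
  -- `u` preserves blocks, so an adjacent descent lies inside one block. Then `w u` and `w` would
  -- send two opposite roots, namely the simple root and minus its image under `u`, both to positive
  -- roots.
  obtain ⟨i, j, hij, hlt⟩ := exists_adjacent_descent hne
  have hlt' : i < j := by rw [Fin.lt_def]; omega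
  have hβ : β.index i = β.index j := by
    refine le_antisymm (index_mono hlt'.le) ?_
    rw [← index_of_mem_parabolic hu i, ← index_of_mem_parabolic hu j]
    exact index_mono hlt.le
  have h₁ := ht_pos_of_mem_cosetReps hwu hlt' hβ
  have h₂ := ht_pos_of_mem_cosetReps hw hlt (by
    rw [index_of_mem_parabolic hu, index_of_mem_parabolic hu, hβ])
  rw [actR_mul, actR_root (fin u)] at h₁
  simp only [fin_right, shift_fin, sub_zero, add_zero] at h₁
  rw [← neg_zero, ← neg_root, actR_neg, map_neg] at h₁
  omega

end Cosets

/-! ### Reflections in affine roots -/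

section Reflections

variable {N : ℕ}

/-- The reflection in the root `ε p - ε q + k δ`. -/
def affRefl (p q : Fin N) (k : ℤ) : AffW N :=
  transl (-k • (eps p - eps q)) * fin (Equiv.swap p q)

theorem shift_affRefl (p q : Fin N) (k : ℤ) (j : Fin N) :
    shift (affRefl p q k) j = -k * (eps p - eps q : Fin N → ℤ) j := by
  rw [affRefl, shift_mul, shift_fin, add_zero]
  rfl

@[simp] theorem affRefl_right (p q : Fin N) (k : ℤ) :
    (affRefl p q k).right = Equiv.swap p q := by
  simp [affRefl, transl]

theorem mul_affRefl (w : AffW N) (p q : Fin N) (k : ℤ) :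
    w * affRefl p q k = affRefl (w.right p) (w.right q)
      (k - shift w (w.right p) + shift w (w.right q)) * w := by
  refine affW_ext ?_ fun j => ?_
  · simp only [SemidirectProduct.mul_right, affRefl_right, Equiv.mul_swap_eq_swap_mul]
  · rw [shift_mul, shift_mul, shift_affRefl, shift_affRefl, affRefl_right, Equiv.symm_swap,
      apply_swap_sub (shift w) (w.right p) (w.right q) j]
    have : (eps p - eps q : Fin N → ℤ) (w.right.symm j) =
        (eps (w.right p) - eps (w.right q) : Fin N → ℤ) j := by
      simp [eps, Pi.single_apply, Equiv.symm_apply_eq]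
    rw [this]
    simp only [eps, Int.cast_id]
    ring

open Classical in
/-- The reflection in a root. -/
noncomputable def reflOf (a : RootLattice N) : AffW N :=
  if h : ∃ x : Fin N × Fin N × ℤ, x.1 ≠ x.2.1 ∧ a = root x.1 x.2.1 x.2.2 then
    affRefl h.choose.1 h.choose.2.1 h.choose.2.2
  else 1

/-- A root determines its indices, so the choice in `reflOf` is harmless. -/
theorem reflOf_root {p q : Fin N} (hpq : p ≠ q) (k : ℤ) :
    reflOf (root p q k) = affRefl p q k := by
  have h : ∃ x : Fin N × Fin N × ℤ, x.1 ≠ x.2.1 ∧ root p q k = root x.1 x.2.1 x.2.2 :=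
    ⟨(p, q, k), hpq, rfl⟩
  obtain ⟨h₁, h₂, h₃⟩ := root_injective hpq h.choose_spec.2
  rw [reflOf, dif_pos h, ← h₁, ← h₂, ← h₃]

theorem mul_reflOf {a : RootLattice N} (ha : a ∈ roots N) (w : AffW N) :
    w * reflOf a = reflOf (actR w a) * w := by
  obtain ⟨p, q, k, hpq, rfl⟩ := ha
  rw [actR_root, reflOf_root hpq, reflOf_root (w.right.injective.ne hpq), mul_affRefl]

theorem reflOf_simpleRoot [NeZero N] (hN : 1 < N) (i : Fin N) :
    reflOf (simpleRoot i) = simpleRefl i := by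
  rw [simpleRoot, reflOf_root (sub_one_ne_self hN i)]
  rfl

end Reflections

/-! ### The module induced from a character of `S[𝔱']` -/

section Principal

variable {N : ℕ}

/-- Left multiplication by `v` on `ℂ[W]`. -/
noncomputable def leftMul (v : AffW N) : Module.End ℂ (AffW N →₀ ℂ) := Finsupp.lmapDomain ℂ ℂ (v * ·)

@[simp] theorem leftMul_single (v w : AffW N) (c : ℂ) :
    leftMul v (Finsupp.single w c) = Finsupp.single (v * w) c := by
  simp [leftMul]

theorem leftMul_one : leftMul (1 : AffW N) = 1 := by
  ext; simp

theorem leftMul_mul (v w : AffW N) : leftMul (v * w) = leftMul v * leftMul w := by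
  ext; simp [mul_assoc]

theorem leftMul_leftMul (v w : AffW N) (x : AffW N →₀ ℂ) :
    leftMul v (leftMul w x) = leftMul (v * w) x := by
  rw [leftMul_mul]; rfl

variable (ζ : Module.Dual ℂ (TPrime N))

/-- The image of the basis vector `w` under `ξ`. -/
noncomputable def torusVec (ξ : TPrime N) (w : AffW N) : AffW N →₀ ℂ :=
  Finsupp.single w (ζ (actT w⁻¹ ξ)) + ∑ a ∈ (inversions_finite w).toFinset,
    Finsupp.single (w * reflOf a) (rootEval a (actT w⁻¹ ξ))

/-- The action of `ξ ∈ 𝔱'` on the module induced from the character `ζ` of `S[𝔱']`, which as a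
representation of `W` is `ℂ[W]`. -/
noncomputable def torusOp (ξ : TPrime N) : Module.End ℂ (AffW N →₀ ℂ) :=
  Finsupp.linearCombination ℂ (torusVec ζ ξ)

@[simp] theorem torusOp_single (ξ : TPrime N) (w : AffW N) :
    torusOp ζ ξ (Finsupp.single w 1) = torusVec ζ ξ w := by
  simp [torusOp]

theorem torusVec_one (ξ : TPrime N) : torusVec ζ ξ 1 = Finsupp.single 1 (ζ ξ) := by
  simp [torusVec, inversions_one]

theorem torusOp_add (ξ η : TPrime N) : torusOp ζ (ξ + η) = torusOp ζ ξ + torusOp ζ η := by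
  ext w : 2
  simp only [LinearMap.comp_apply, Finsupp.lsingle_apply, LinearMap.add_apply, torusOp_single,
    torusVec, actT_add, map_add, rootEval_add_right, Finsupp.single_add, Finset.sum_add_distrib]
  abel

theorem torusOp_smul (c : ℂ) (ξ : TPrime N) : torusOp ζ (c • ξ) = c • torusOp ζ ξ := by
  ext w : 2
  simp only [LinearMap.comp_apply, Finsupp.lsingle_apply, LinearMap.smul_apply, torusOp_single,
    torusVec, actT_smul, map_smul, rootEval_smul_right, smul_add, Finset.smul_sum,
    Finsupp.smul_single, smul_eq_mul]

/-- The operators `ξ ↦ torusOp ζ ξ` as a linear map. -/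
noncomputable def torusLin : TPrime N →ₗ[ℂ] Module.End ℂ (AffW N →₀ ℂ) where
  toFun := torusOp ζ
  map_add' := torusOp_add ζ
  map_smul' := torusOp_smul ζ

theorem torusOp_sub (ξ η : TPrime N) : torusOp ζ (ξ - η) = torusOp ζ ξ - torusOp ζ η :=
  map_sub (torusLin ζ) ξ η

theorem torusOp_single_one (ξ : TPrime N) :
    torusOp ζ ξ (Finsupp.single 1 1) = ζ ξ • Finsupp.single 1 1 := by
  rw [torusOp_single, torusVec_one, Finsupp.smul_single, smul_eq_mul, mul_one]

variable [NeZero N]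

theorem rootEval_simpleRoot_eq_zero (hN : N = 1) (i : Fin N) (ξ : TPrime N) :
    rootEval (simpleRoot i) ξ = 0 := by
  subst hN
  rw [simpleRoot, rootEval_root, Subsingleton.elim (i - 1) i, sub_self]

theorem rootEval_simpleRoot_actT (i : Fin N) (ξ : TPrime N) :
    rootEval (simpleRoot i) (actT (simpleRefl i) ξ) = -rootEval (simpleRoot i) ξ := by
  rcases one_lt_or_eq_one (N := N) with hN | hN
  · rw [← rootEval_neg, ← actR_simpleRefl_self hN, ← rootEval_actR (simpleRefl i),
      actT_simpleRefl_simpleRefl]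
  · rw [rootEval_simpleRoot_eq_zero hN, rootEval_simpleRoot_eq_zero hN, neg_zero]

/-- Passing from `w` to `s_i w` adds the single inversion `b = w⁻¹ α_i`, and `s_i w s_b = w`. Its
term is exactly the scalar in the defining relation; all other terms match. -/
theorem leftMul_torusVec_of_pos (hN : 1 < N) {i : Fin N} {w : AffW N}
    (h : 0 < ht (actR w⁻¹ (simpleRoot i))) (ξ : TPrime N) :
    leftMul (simpleRefl i) (torusVec ζ ξ w) - torusVec ζ (actT (simpleRefl i) ξ) (simpleRefl i * w)
      = Finsupp.single w (-rootEval (simpleRoot i) ξ) := by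
  have hb : actR w⁻¹ (simpleRoot i) ∉ (inversions_finite w).toFinset := by
    rw [Set.Finite.mem_toFinset, mem_inversions_iff, actR_actR_inv, ht_simpleRoot]
    omega
  have hS : (inversions_finite (simpleRefl i * w)).toFinset =
      insert (actR w⁻¹ (simpleRoot i)) (inversions_finite w).toFinset := by
    ext a
    simp [inversions_simpleRefl_mul hN h]
  have hw : simpleRefl i * (w * reflOf (actR w⁻¹ (simpleRoot i))) = w := by
    rw [mul_reflOf (actR_mem_roots (simpleRoot_mem_roots hN i)), actR_actR_inv,
      reflOf_simpleRoot hN, simpleRefl_mul_cancel_left]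
  simp only [torusVec, mul_inv_rev, simpleRefl_inv, actT_mul, actT_simpleRefl_simpleRefl, hS,
    Finset.sum_insert hb, hw, rootEval_actR, map_add, map_sum, leftMul_single, mul_assoc,
    Finsupp.single_neg]
  abel

theorem leftMul_torusVec (i : Fin N) (ξ : TPrime N) (w : AffW N) :
    leftMul (simpleRefl i) (torusVec ζ ξ w) - torusVec ζ (actT (simpleRefl i) ξ) (simpleRefl i * w)
      = Finsupp.single w (-rootEval (simpleRoot i) ξ) := by
  rcases one_lt_or_eq_one (N := N) with hN | hN
  · rcases (ht_ne_zero (actR_mem_roots (w := w⁻¹) (simpleRoot_mem_roots hN i))).lt_or_gt with h | h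
    -- The positive case for `s_i w` and `s_i ξ`, multiplied by `s_i`, gives the negative case.
    · have h' := leftMul_torusVec_of_pos ζ hN (w := simpleRefl i * w) (i := i) (by
        rw [mul_inv_rev, actR_mul, simpleRefl_inv, actR_simpleRefl_self hN, actR_neg, map_neg]
        omega) (actT (simpleRefl i) ξ)
      have h'' := congrArg (leftMul (simpleRefl i)) h'
      rw [map_sub, leftMul_leftMul, simpleRefl_mul_self, leftMul_one, simpleRefl_mul_cancel_left,
        actT_simpleRefl_simpleRefl, leftMul_single, simpleRefl_mul_cancel_left,
        Module.End.one_apply] at h''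
      rw [rootEval_simpleRoot_actT, neg_neg] at h''
      rw [Finsupp.single_neg, ← h'', neg_sub]
    · exact leftMul_torusVec_of_pos ζ hN h ξ
  · have h₁ : simpleRefl i = 1 := simpleRefl_eq_one hN i
    simp [h₁, rootEval_simpleRoot_eq_zero hN, leftMul_one]

theorem leftMul_torusOp (i : Fin N) (ξ : TPrime N) :
    leftMul (simpleRefl i) * torusOp ζ ξ - torusOp ζ (actT (simpleRefl i) ξ) *
      leftMul (simpleRefl i) = algebraMap ℂ _ (-rootEval (simpleRoot i) ξ) := by
  ext w : 2
  simpa [Algebra.algebraMap_eq_smul_one] using leftMul_torusVec ζ i ξ w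

theorem leftMul_piElt_torusOp (ξ : TPrime N) :
    leftMul (piElt N) * torusOp ζ ξ = torusOp ζ (actT (piElt N) ξ) * leftMul (piElt N) := by
  ext w : 2
  have hS : (inversions_finite (piElt N * w)).toFinset = (inversions_finite w).toFinset := by
    have := inversions_piElt_zpow_mul 1 w
    rw [zpow_one] at this
    ext a
    simp [this]
  simp [torusVec, hS, actT_mul, mul_assoc]

theorem torusOp_simpleRefl_apply (i : Fin N) (ξ : TPrime N) (x : AffW N →₀ ℂ) :
    torusOp ζ ξ (leftMul (simpleRefl i) x) =
      leftMul (simpleRefl i) (torusOp ζ (actT (simpleRefl i) ξ) x) -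
        rootEval (simpleRoot i) ξ • x := by
  have h := LinearMap.congr_fun (leftMul_torusOp ζ i (actT (simpleRefl i) ξ)) x
  simp only [actT_simpleRefl_simpleRefl, LinearMap.sub_apply, Module.End.mul_apply,
    rootEval_simpleRoot_actT, neg_neg, Module.algebraMap_end_apply] at h
  rw [← h]
  abel

theorem torusOp_piElt_inv_apply (ξ : TPrime N) (x : AffW N →₀ ℂ) :
    torusOp ζ ξ (leftMul (piElt N)⁻¹ x) =
      leftMul (piElt N)⁻¹ (torusOp ζ (actT (piElt N) ξ) x) := by
  have h := LinearMap.congr_fun (leftMul_piElt_torusOp ζ ξ) (leftMul (piElt N)⁻¹ x)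
  have h' := congrArg (leftMul (piElt N)⁻¹) h
  simpa [leftMul_leftMul, leftMul_one] using h'

theorem torusOp_piElt_apply (ξ : TPrime N) (x : AffW N →₀ ℂ) :
    torusOp ζ ξ (leftMul (piElt N) x) =
      leftMul (piElt N) (torusOp ζ (actT (piElt N)⁻¹ ξ) x) := by
  have h := LinearMap.congr_fun (leftMul_piElt_torusOp ζ (actT (piElt N)⁻¹ ξ)) x
  simpa using h.symm

/-- Commutativity spreads from the eigenvector `1` along generators. For `s_i` the correction terms
of the two orders agree once `s_i ξ` is written as `ξ - α_i(ξ) α_i^∨`. -/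
theorem torusOp_comm_apply (ξ η : TPrime N) (w : AffW N) :
    torusOp ζ ξ (torusOp ζ η (Finsupp.single w 1)) =
      torusOp ζ η (torusOp ζ ξ (Finsupp.single w 1)) := by
  induction w using affW_induction generalizing ξ η with
  | one =>
    simp only [torusOp_single_one, map_smul, smul_smul, mul_comm]
  | refl i w ih =>
    rw [← leftMul_single]
    have h : ∀ ξ, torusOp ζ (actT (simpleRefl i) ξ) (Finsupp.single w 1) =
        torusOp ζ ξ (Finsupp.single w 1) - rootEval (simpleRoot i) ξ •
          torusOp ζ (coroot (simpleRoot i)) (Finsupp.single w 1) := fun ξ => by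
      rw [actT_simpleRefl, torusOp_sub, torusOp_smul]
      rfl
    have h' := ih (actT (simpleRefl i) ξ) (actT (simpleRefl i) η)
    simp only [torusOp_simpleRefl_apply, map_sub, map_smul]
    rw [h', h ξ, h η]
    module
  | pi w ih =>
    rw [← leftMul_single]
    simp only [torusOp_piElt_apply, ih]
  | pi_inv w ih =>
    rw [← leftMul_single]
    simp only [torusOp_piElt_inv_apply, ih]

/-- The generators of `H` acting on the principal series module. -/
noncomputable def principalFree :
    FreeAlgebra ℂ (AffW N ⊕ TPrime N) →ₐ[ℂ] Module.End ℂ (AffW N →₀ ℂ) :=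
  FreeAlgebra.lift ℂ (Sum.elim leftMul (torusOp ζ))

theorem principalFree_rel {x y : FreeAlgebra ℂ (AffW N ⊕ TPrime N)} (h : Rel N x y) :
    principalFree ζ x = principalFree ζ y := by
  induction h with
  | one => simp [principalFree, leftMul_one]
  | mul v w => simp [principalFree, leftMul_mul]
  | add ξ η => simp [principalFree, torusOp_add]
  | smul a ξ => simp [principalFree, torusOp_smul]
  | comm ξ η =>
    simp only [principalFree, map_mul, FreeAlgebra.lift_ι_apply, Sum.elim_inr]
    ext w : 2
    exact torusOp_comm_apply ζ ξ η w
  | refl i ξ =>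
    simpa only [principalFree, map_mul, map_sub, FreeAlgebra.lift_ι_apply, Sum.elim_inr,
      Sum.elim_inl, AlgHom.commutes] using leftMul_torusOp ζ i ξ
  | pi ξ =>
    simpa only [principalFree, map_mul, FreeAlgebra.lift_ι_apply, Sum.elim_inr,
      Sum.elim_inl] using leftMul_piElt_torusOp ζ ξ

/-- The principal series representation of `H` attached to `ζ`. -/
noncomputable def principal : H N →ₐ[ℂ] Module.End ℂ (AffW N →₀ ℂ) :=
  RingQuot.liftAlgHom ℂ ⟨principalFree ζ, fun _ _ => principalFree_rel ζ⟩

theorem principal_ofW (w : AffW N) : principal ζ (ofW w) = leftMul w :=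
  (RingQuot.liftAlgHom_mkAlgHom_apply ℂ _ _ _).trans (by simp [principalFree])

theorem principal_ofT (ξ : TPrime N) : principal ζ (ofT ξ) = torusOp ζ ξ :=
  (RingQuot.liftAlgHom_mkAlgHom_apply ℂ _ _ _).trans (by simp [principalFree])

end Principal

/-! ### The kernel of `ℂ[W] → ℂ[W / W_β]` -/

section Kernel

variable {N : ℕ} (β : Composition N)

/-- The kernel of the projection `ℂ[W] → ℂ[W / W_β]`. -/
noncomputable def cosetKer : Submodule ℂ (AffW N →₀ ℂ) :=
  Submodule.span ℂ {x | ∃ (w : AffW N) (u : Equiv.Perm (Fin N)), u ∈ parabolic β ∧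
    x = Finsupp.single (w * fin u) 1 - Finsupp.single w 1}

variable {β}

theorem sub_mem_cosetKer (w : AffW N) {u : Equiv.Perm (Fin N)} (hu : u ∈ parabolic β) :
    Finsupp.single (w * fin u) 1 - Finsupp.single w 1 ∈ cosetKer β :=
  Submodule.subset_span ⟨w, u, hu, rfl⟩

theorem leftMul_mem_cosetKer (v : AffW N) {x : AffW N →₀ ℂ} (hx : x ∈ cosetKer β) :
    leftMul v x ∈ cosetKer β := by
  induction hx using Submodule.span_induction with
  | mem x hx =>
    obtain ⟨w, u, hu, rfl⟩ := hx
    rw [map_sub, leftMul_single, leftMul_single, ← mul_assoc]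
    exact sub_mem_cosetKer _ hu
  | zero => simp
  | add x y _ _ hx hy => rw [map_add]; exact add_mem hx hy
  | smul a x _ hx => rw [map_smul]; exact Submodule.smul_mem _ _ hx

variable (β) in
open Classical in
/-- The linear form on `ℂ[W]` which is the indicator function of the coset of `w`. -/
noncomputable def cosetForm (w : AffW N) : (AffW N →₀ ℂ) →ₗ[ℂ] ℂ :=
  Finsupp.linearCombination ℂ fun v => if ∃ u ∈ parabolic β, v = w * fin u then 1 else 0

open Classical in
theorem cosetForm_single (w v : AffW N) :
    cosetForm β w (Finsupp.single v 1) =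
      if ∃ u ∈ parabolic β, v = w * fin u then 1 else 0 := by
  simp [cosetForm]

/-- The indicator of a coset is invariant under right multiplication by `W_β`. -/
theorem cosetForm_eq_zero (w : AffW N) {x : AffW N →₀ ℂ} (hx : x ∈ cosetKer β) :
    cosetForm β w x = 0 := by
  suffices cosetKer β ≤ LinearMap.ker (cosetForm β w) from this hx
  refine Submodule.span_le.2 ?_
  rintro _ ⟨v, u, hu, rfl⟩
  have : (∃ u' ∈ parabolic β, v * fin u = w * fin u') ↔ ∃ u' ∈ parabolic β, v = w * fin u' := by
    constructor
    · rintro ⟨u', hu', h⟩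
      refine ⟨u' * u⁻¹, mul_mem hu' (inv_mem hu), ?_⟩
      rw [fin_mul, ← mul_assoc, ← h, fin_inv, mul_inv_cancel_right]
    · rintro ⟨u', hu', rfl⟩
      exact ⟨u' * u, mul_mem hu' hu, by rw [fin_mul, mul_assoc]⟩
  simp only [SetLike.mem_coe, LinearMap.mem_ker, map_sub, cosetForm_single, sub_eq_zero]
  by_cases h : ∃ u' ∈ parabolic β, v = w * fin u'
  · rw [if_pos h, if_pos (this.2 h)]
  · rw [if_neg h, if_neg (mt this.1 h)]

theorem cosetForm_one_one : cosetForm β 1 (Finsupp.single 1 1) = 1 := by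
  rw [cosetForm_single, if_pos ⟨1, one_mem _, by simp⟩]

variable [NeZero N] {ζ : Module.Dual ℂ (TPrime N)}

theorem apply_coroot_simpleRoot (hζ : ζ ∈ weights β) {i j : Fin N} (h : IsBetaSimple β i j) :
    ζ (coroot (simpleRoot j)) = -1 := by
  obtain ⟨hj, rfl⟩ := h.eq_sub_one
  rw [simpleRoot_of_ne_zero hj, hζ _ _ h]

/-- Here the condition `ζ(α_j) = -1` enters: it is what makes `s_j - 1` a weight vector. -/
theorem torusOp_single_simpleRefl_sub (hζ : ζ ∈ weights β) {i j : Fin N} (h : IsBetaSimple β i j)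
    (ξ : TPrime N) :
    torusOp ζ ξ (Finsupp.single (simpleRefl j) 1 - Finsupp.single 1 1) =
      (ζ ξ + rootEval (simpleRoot j) ξ) •
        (Finsupp.single (simpleRefl j) 1 - Finsupp.single 1 1) := by
  have h₁ := torusOp_simpleRefl_apply ζ j ξ (Finsupp.single 1 1)
  rw [torusOp_single_one, map_smul, leftMul_single, mul_one, actT_simpleRefl, map_sub, map_smul,
    apply_coroot_simpleRoot hζ h] at h₁
  rw [map_sub, h₁, torusOp_single_one, smul_eq_mul]
  module

/-- Induction over generators of `W_β`, based on `s_j τ - 1 = s_j (τ - 1) + (s_j - 1)`. -/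
theorem torusOp_single_fin_sub_mem (hζ : ζ ∈ weights β) {u : Equiv.Perm (Fin N)}
    (hu : u ∈ parabolic β) (ξ : TPrime N) :
    torusOp ζ ξ (Finsupp.single (fin u) 1 - Finsupp.single 1 1) ∈ cosetKer β := by
  have step : ∀ {i j : Fin N} {τ : Equiv.Perm (Fin N)} (ξ : TPrime N), IsBetaSimple β i j →
      τ ∈ parabolic β →
      (∀ ξ, torusOp ζ ξ (Finsupp.single (fin τ) 1 - Finsupp.single 1 1) ∈ cosetKer β) →
      torusOp ζ ξ (Finsupp.single (fin (Equiv.swap i j * τ)) 1 - Finsupp.single 1 1) ∈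
        cosetKer β := by
    intro i j τ ξ hij hτ ih
    have h₁ : (Finsupp.single (fin (Equiv.swap i j * τ)) 1 - Finsupp.single 1 1 : AffW N →₀ ℂ) =
        leftMul (simpleRefl j) (Finsupp.single (fin τ) 1 - Finsupp.single 1 1) +
          (Finsupp.single (simpleRefl j) 1 - Finsupp.single 1 1) := by
      rw [map_sub, leftMul_single, leftMul_single, fin_mul, hij.fin_swap, mul_one]
      abel
    have h₂ : Finsupp.single (fin τ) 1 - Finsupp.single 1 1 ∈ cosetKer β := by
      simpa using sub_mem_cosetKer 1 hτ
    have h₃ : Finsupp.single (simpleRefl j) 1 - Finsupp.single 1 1 ∈ cosetKer β := by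
      simpa [hij.fin_swap] using sub_mem_cosetKer 1 hij.swap_mem_parabolic
    rw [h₁, map_add, torusOp_simpleRefl_apply, torusOp_single_simpleRefl_sub hζ hij]
    exact add_mem (sub_mem (leftMul_mem_cosetKer _ (ih _)) (Submodule.smul_mem _ _ h₂))
      (Submodule.smul_mem _ _ h₃)
  induction hu using Subgroup.closure_induction_left generalizing ξ with
  | one => simp
  | mul_left σ hσ τ hτ ih =>
    obtain ⟨i, j, hij, rfl⟩ := hσ
    exact step ξ hij hτ ih
  | inv_mul_cancel σ hσ τ hτ ih =>
    obtain ⟨i, j, hij, rfl⟩ := hσ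
    rw [Equiv.swap_inv]
    exact step ξ hij hτ ih

theorem torusOp_mem_cosetKer (hζ : ζ ∈ weights β) (ξ : TPrime N) {x : AffW N →₀ ℂ}
    (hx : x ∈ cosetKer β) : torusOp ζ ξ x ∈ cosetKer β := by
  induction hx using Submodule.span_induction with
  | mem x hx =>
    obtain ⟨w, u, hu, rfl⟩ := hx
    induction w using affW_induction generalizing ξ with
    | one =>
      rw [one_mul]
      exact torusOp_single_fin_sub_mem hζ hu ξ
    | refl i w ih =>
      rw [mul_assoc, ← leftMul_single, ← leftMul_single _ w, ← map_sub, torusOp_simpleRefl_apply]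
      exact sub_mem (leftMul_mem_cosetKer _ (ih _)) (Submodule.smul_mem _ _ (sub_mem_cosetKer w hu))
    | pi w ih =>
      rw [mul_assoc, ← leftMul_single, ← leftMul_single _ w, ← map_sub, torusOp_piElt_apply]
      exact leftMul_mem_cosetKer _ (ih _)
    | pi_inv w ih =>
      rw [mul_assoc, ← leftMul_single, ← leftMul_single _ w, ← map_sub, torusOp_piElt_inv_apply]
      exact leftMul_mem_cosetKer _ (ih _)
  | zero => simp
  | add x y _ _ hx hy => rw [map_add]; exact add_mem hx hy
  | smul a x _ hx => rw [map_smul]; exact Submodule.smul_mem _ _ hx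

theorem H_induction {P : H N → Prop} (ofW : ∀ w, P (ofW w)) (ofT : ∀ ξ, P (ofT ξ))
    (algebraMap : ∀ c, P (algebraMap ℂ (H N) c)) (add : ∀ x y, P x → P y → P (x + y))
    (mul : ∀ x y, P x → P y → P (x * y)) (x : H N) : P x := by
  obtain ⟨x, rfl⟩ := RingQuot.mkAlgHom_surjective ℂ (Rel N) x
  induction x using FreeAlgebra.induction with
  | grade0 c => rw [AlgHom.commutes]; exact algebraMap c
  | grade1 g =>
    rcases g with w | ξ
    · exact ofW w
    · exact ofT ξ
  | mul x y hx hy => rw [map_mul]; exact mul _ _ hx hy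
  | add x y hx hy => rw [map_add]; exact add _ _ hx hy

theorem principal_mem_cosetKer (hζ : ζ ∈ weights β) (a : H N) {x : AffW N →₀ ℂ}
    (hx : x ∈ cosetKer β) : principal ζ a x ∈ cosetKer β := by
  induction a using H_induction generalizing x with
  | ofW w => rw [principal_ofW]; exact leftMul_mem_cosetKer w hx
  | ofT ξ => rw [principal_ofT]; exact torusOp_mem_cosetKer hζ ξ hx
  | algebraMap c =>
    rw [AlgHom.commutes, Module.algebraMap_end_apply]
    exact Submodule.smul_mem _ _ hx
  | add a b ha hb => rw [map_add]; exact add_mem (ha hx) (hb hx)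
  | mul a b ha hb => rw [map_mul]; exact ha (hb hx)

/-! ### The character of the parabolic subalgebra -/

/-- Modulo `cosetKer β` the line of the vector `1` is stable under the generators of `H_β`; the
scalar `c` becomes the character. -/
theorem principal_parabolicH (hζ : ζ ∈ weights β) {b : H N} (hb : b ∈ parabolicH β) :
    ∃ c : ℂ, principal ζ b (Finsupp.single 1 1) - c • Finsupp.single 1 1 ∈ cosetKer β := by
  induction hb using Algebra.adjoin_induction with
  | mem b hb =>
    rcases hb with ⟨u, hu, rfl⟩ | ⟨ξ, rfl⟩
    · refine ⟨1, ?_⟩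
      rw [principal_ofW, leftMul_single, one_smul, mul_one]
      simpa using sub_mem_cosetKer 1 hu
    · refine ⟨ζ ξ, ?_⟩
      rw [principal_ofT, torusOp_single, torusVec_one, Finsupp.smul_single, smul_eq_mul, mul_one,
        sub_self]
      exact zero_mem _
  | algebraMap c => exact ⟨c, by simp⟩
  | add a b _ _ ha hb =>
    obtain ⟨c, hc⟩ := ha
    obtain ⟨d, hd⟩ := hb
    refine ⟨c + d, ?_⟩
    rw [map_add, LinearMap.add_apply, add_smul, add_sub_add_comm]
    exact add_mem hc hd
  | mul a b _ _ ha hb =>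
    obtain ⟨c, hc⟩ := ha
    obtain ⟨d, hd⟩ := hb
    refine ⟨c * d, ?_⟩
    have h₁ := principal_mem_cosetKer hζ a hd
    have h₂ := Submodule.smul_mem _ d hc
    rw [map_sub, map_smul] at h₁
    have := add_mem h₁ h₂
    rw [smul_sub, smul_smul, sub_add_sub_cancel, mul_comm d] at this
    rwa [map_mul, Module.End.mul_apply]

theorem principal_parabolicH_sub_mem (hζ : ζ ∈ weights β) {b : H N} (hb : b ∈ parabolicH β) :
    principal ζ b (Finsupp.single 1 1) - cosetForm β 1 (principal ζ b (Finsupp.single 1 1)) •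
      Finsupp.single 1 1 ∈ cosetKer β := by
  obtain ⟨c, hc⟩ := principal_parabolicH hζ hb
  have := cosetForm_eq_zero 1 hc
  rw [map_sub, map_smul, cosetForm_one_one, smul_eq_mul, mul_one, sub_eq_zero] at this
  rwa [this]

/-- The character of the parabolic subalgebra attached to `ζ`. -/
noncomputable def parabolicChar (hζ : ζ ∈ weights β) : parabolicH β →ₐ[ℂ] ℂ :=
  AlgHom.ofLinearMap
    ((cosetForm β 1).comp ((LinearMap.applyₗ (Finsupp.single 1 1)).comp
      ((principal ζ).toLinearMap.comp (parabolicH β).val.toLinearMap)))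
    (by simp [cosetForm_one_one])
    (fun a b => by
      have h := cosetForm_eq_zero 1
        (principal_mem_cosetKer hζ (a : H N) (principal_parabolicH_sub_mem hζ b.2))
      rw [map_sub, map_sub, map_smul, map_smul, sub_eq_zero, smul_eq_mul, mul_comm] at h
      simpa using h)

theorem parabolicChar_apply (hζ : ζ ∈ weights β) (b : parabolicH β) :
    parabolicChar hζ b = cosetForm β 1 (principal ζ (b : H N) (Finsupp.single 1 1)) := rfl

theorem parabolicChar_isCharacter (hζ : ζ ∈ weights β) : IsCharacter β ζ (parabolicChar hζ) := by
  constructor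
  · intro x σ hσ hx
    rw [parabolicChar_apply, hx, principal_ofW, leftMul_single, cosetForm_single,
      if_pos ⟨σ, hσ, by simp⟩]
  · intro x ξ hx
    rw [parabolicChar_apply, hx, principal_ofT, torusOp_single, torusVec_one,
      ← mul_one (ζ ξ), ← smul_eq_mul, ← Finsupp.smul_single, map_smul, cosetForm_one_one]

/-- This is the balancing condition under which the coset forms descend to the induced module. -/
theorem cosetForm_principal_mul (hζ : ζ ∈ weights β) (w : AffW N) (a : H N) (b : parabolicH β) :
    cosetForm β w (principal ζ (a * b) (Finsupp.single 1 1)) =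
      parabolicChar hζ b * cosetForm β w (principal ζ a (Finsupp.single 1 1)) := by
  have h := cosetForm_eq_zero w
    (principal_mem_cosetKer hζ a (principal_parabolicH_sub_mem hζ b.2))
  rw [map_sub, map_sub, map_smul, map_smul, sub_eq_zero, smul_eq_mul] at h
  rw [map_mul, Module.End.mul_apply, h, parabolicChar_apply]

end Kernel

/-! ### Modules generated by a weight vector fixed by the parabolic subgroup

To treat `H` and `Hbar` at once, `tw` and `tt` are the maps which send `w ∈ W` and `ξ ∈ 𝔱'` to an
algebra `A`; the relations of `H` are only required for those generators which occur in reduced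
expressions of the elements of a subgroup `G` of `W`. -/

section Realization

variable {N : ℕ} [NeZero N] {A : Type} [Ring A] [Algebra ℂ A]

/-- The relation between a simple reflection and `𝔱'`. -/
def SatisfiesRefl (tw : AffW N →* A) (tt : TPrime N →ₗ[ℂ] A) (j : Fin N) : Prop :=
  ∀ ξ, tw (simpleRefl j) * tt ξ - tt (actT (simpleRefl j) ξ) * tw (simpleRefl j) =
    algebraMap ℂ A (-rootEval (simpleRoot j) ξ)

/-- The maps `tw`, `tt` satisfy the relations of `H` on the subgroup `G`. -/
structure IsRealization (β : Composition N) (G : Subgroup (AffW N)) (tw : AffW N →* A)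
    (tt : TPrime N →ₗ[ℂ] A) : Prop where
  comm : ∀ ξ η, tt ξ * tt η = tt η * tt ξ
  refl_mem : ∀ w ∈ G, ∀ e, IsReducedExpr w e → ∀ j ∈ e.2, simpleRefl j ∈ G
  refl : ∀ w ∈ G, ∀ e, IsReducedExpr w e → ∀ j ∈ e.2, SatisfiesRefl tw tt j
  pi_mem : ∀ w ∈ G, ∀ e, IsReducedExpr w e → piElt N ^ e.1 ∈ G
  pi : ∀ w ∈ G, ∀ e, IsReducedExpr w e → ∀ ξ,
    tw (piElt N ^ e.1) * tt ξ = tt (actT (piElt N ^ e.1) ξ) * tw (piElt N ^ e.1)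
  fin_mem : ∀ u ∈ parabolic β, fin u ∈ G
  adjoin : Algebra.adjoin ℂ (tw '' G ∪ Set.range tt) = ⊤

/-- The intertwiner of a simple reflection. -/
def intertwiner (tw : AffW N →* A) (tt : TPrime N →ₗ[ℂ] A) (j : Fin N) : A :=
  1 + tw (simpleRefl j) * tt (coroot (simpleRoot j))

/-- The product of intertwiners attached to a word. -/
def wordPhi (tw : AffW N →* A) (tt : TPrime N →ₗ[ℂ] A) (js : List (Fin N)) : A :=
  (js.map (intertwiner tw tt)).prod

variable {tw : AffW N →* A} {tt : TPrime N →ₗ[ℂ] A}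

@[simp] theorem wordPhi_nil : wordPhi tw tt [] = 1 := rfl

@[simp] theorem wordPhi_cons (j : Fin N) (js : List (Fin N)) :
    wordPhi tw tt (j :: js) = intertwiner tw tt j * wordPhi tw tt js := by
  simp [wordPhi]

theorem SatisfiesRefl.tt_mul {j : Fin N} (h : SatisfiesRefl tw tt j) (ξ : TPrime N) :
    tt ξ * tw (simpleRefl j) = tw (simpleRefl j) * tt (actT (simpleRefl j) ξ) -
      algebraMap ℂ A (rootEval (simpleRoot j) ξ) := by
  have := h (actT (simpleRefl j) ξ)
  rw [actT_simpleRefl_simpleRefl, rootEval_simpleRoot_actT, neg_neg] at this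
  rw [← this, sub_sub_cancel]

/-- Moving `ξ` past `s_j` costs `α_j(ξ)`, which turns the summand `ξ` into `ξ - α_j(ξ) α_j^∨ =
s_j(ξ)`. -/
theorem SatisfiesRefl.tt_mul_intertwiner (hc : ∀ ξ η, tt ξ * tt η = tt η * tt ξ) {j : Fin N}
    (h : SatisfiesRefl tw tt j) (ξ : TPrime N) :
    tt ξ * intertwiner tw tt j = intertwiner tw tt j * tt (actT (simpleRefl j) ξ) := by
  have h₁ : tt (actT (simpleRefl j) ξ) = tt ξ - algebraMap ℂ A (rootEval (simpleRoot j) ξ) *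
      tt (coroot (simpleRoot j)) := by
    rw [actT_simpleRefl, map_sub, map_smul, Algebra.smul_def]
  rw [intertwiner, mul_add, add_mul, one_mul, mul_one, ← mul_assoc, h.tt_mul, sub_mul, mul_assoc,
    mul_assoc, hc (coroot _)]
  nth_rw 2 [h₁]
  abel

/-- From `α s = -s α - 2`. On a vector of weight other than `±1` at `α_j^∨`, the intertwiner can
therefore be undone. -/
theorem SatisfiesRefl.intertwiner_mul_self {j : Fin N} (hN : 1 < N)
    (h : SatisfiesRefl tw tt j) :
    intertwiner tw tt j * intertwiner tw tt j =
      1 - tt (coroot (simpleRoot j)) * tt (coroot (simpleRoot j)) := by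
  have h₁ := h.tt_mul (coroot (simpleRoot j))
  have h₂ : rootEval (simpleRoot j) (coroot (simpleRoot j)) = 2 := by
    have hne := sub_one_ne_self hN j
    rw [simpleRoot, rootEval_root]
    simp [coroot, root, eps, hne, hne.symm]
    norm_num
  rw [← coroot_actR, actR_simpleRefl_self hN, coroot_neg, map_neg, h₂] at h₁
  rw [intertwiner]
  set s := tw (simpleRefl j)
  set α := tt (coroot (simpleRoot j))
  have h₃ : s * α * (s * α) = -(α * α) - 2 * (s * α) := by
    calc s * α * (s * α) = s * (α * s) * α := by noncomm_ring
      _ = -(s * s * α * α) - s * algebraMap ℂ A 2 * α := by rw [h₁]; noncomm_ring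
      _ = _ := by
        rw [← map_mul, simpleRefl_mul_self, map_one, map_ofNat]
        noncomm_ring
  rw [add_mul, mul_add, mul_add, h₃]
  noncomm_ring

variable {M : Type} [AddCommGroup M] [Module ℂ M] [Module A M] [IsScalarTower ℂ A M]
  {ζ : Module.Dual ℂ (TPrime N)} {y : M}

theorem tt_smul_wordPhi_smul (hc : ∀ ξ η, tt ξ * tt η = tt η * tt ξ)
    (hy : ∀ ξ, tt ξ • y = ζ ξ • y) {js : List (Fin N)} (hjs : ∀ j ∈ js, SatisfiesRefl tw tt j)
    (ξ : TPrime N) :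
    tt ξ • wordPhi tw tt js • y =
      ζ (actT ((js.map simpleRefl).prod)⁻¹ ξ) • wordPhi tw tt js • y := by
  induction js generalizing ξ with
  | nil => simp [hy]
  | cons j js ih =>
    rw [List.forall_mem_cons] at hjs
    rw [wordPhi_cons, mul_smul, ← mul_smul, hjs.1.tt_mul_intertwiner hc, mul_smul, ih hjs.2,
      List.map_cons, List.prod_cons, mul_inv_rev, simpleRefl_inv, actT_mul]
    exact smul_comm _ _ _

/-- The span of the vectors `w y` with `l(w) < n`. -/
def lowerSpan (G : Subgroup (AffW N)) (tw : AffW N →* A) (y : M) (n : ℕ) : Submodule ℂ M :=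
  Submodule.span ℂ {x | ∃ u ∈ G, length u < n ∧ x = tw u • y}

omit [NeZero N] [Algebra ℂ A] [IsScalarTower ℂ A M] in
theorem lowerSpan_mono {G : Subgroup (AffW N)} {m n : ℕ} (h : m ≤ n) :
    lowerSpan G tw y m ≤ lowerSpan G tw y n :=
  Submodule.span_mono fun _ ⟨u, h₁, h₂, h₃⟩ => ⟨u, h₁, h₂.trans_le h, h₃⟩

omit [NeZero N] in
theorem smul_mem_lowerSpan {G : Subgroup (AffW N)} {g : AffW N} (hg : g ∈ G) {m n : ℕ}
    (h : ∀ u, length u < m → length (g * u) < n) {x : M} (hx : x ∈ lowerSpan G tw y m) :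
    tw g • x ∈ lowerSpan G tw y n := by
  induction hx using Submodule.span_induction with
  | mem x hx =>
    obtain ⟨u, hu, hl, rfl⟩ := hx
    refine Submodule.subset_span ⟨g * u, mul_mem hg hu, h u hl, ?_⟩
    rw [map_mul, mul_smul]
  | zero => simp
  | add x z _ _ hx hz => rw [smul_add]; exact add_mem hx hz
  | smul a x _ hx => rw [smul_comm]; exact Submodule.smul_mem _ _ hx

/-- On a weight vector `x`, `φ_j x = x + z s_j x`, where `z` is the value of `ζ` at the inversion
that the letter `j` adds. The leading coefficient is the product of these values. -/
theorem wordPhi_smul_sub_mem {G : Subgroup (AffW N)} (hc : ∀ ξ η, tt ξ * tt η = tt η * tt ξ)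
    (hy : ∀ ξ, tt ξ • y = ζ ξ • y) {js : List (Fin N)} (hjs : ∀ j ∈ js, SatisfiesRefl tw tt j)
    (hG : ∀ j ∈ js, simpleRefl j ∈ G) (hred : IsReducedWord js)
    (hζ : ∀ a ∈ inversions (js.map simpleRefl).prod, ζ (coroot a) ≠ 0) :
    ∃ c : ℂ, c ≠ 0 ∧ wordPhi tw tt js • y - c • tw (js.map simpleRefl).prod • y ∈
      lowerSpan G tw y js.length := by
  induction js with
  | nil => exact ⟨1, one_ne_zero, by simp⟩
  | cons j js ih =>
    rw [List.forall_mem_cons] at hjs hG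
    rw [hred.inversions_cons] at hζ
    obtain ⟨c, hc₀, hmem⟩ := ih hjs.2 hG.2 hred.of_cons fun a ha =>
      hζ a (Set.mem_insert_of_mem _ ha)
    have hred' : length (js.map simpleRefl).prod = js.length := hred.of_cons
    have hGp : (js.map simpleRefl).prod ∈ G :=
      list_prod_mem fun x hx => by
        obtain ⟨i, hi, rfl⟩ := List.mem_map.1 hx
        exact hG.2 i hi
    have h₀ := hζ _ (Set.mem_insert _ _)
    rw [coroot_actR] at h₀
    have hw := tt_smul_wordPhi_smul hc hy hjs.2 (coroot (simpleRoot j))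
    set v := (js.map simpleRefl).prod with hv
    set z := ζ (actT v⁻¹ (coroot (simpleRoot j)))
    set x := wordPhi tw tt js • y with hx
    refine ⟨z * c, mul_ne_zero h₀ hc₀, ?_⟩
    have h₁ : wordPhi tw tt (j :: js) • y - (z * c) • tw ((j :: js).map simpleRefl).prod • y =
        (x - c • tw v • y) + c • tw v • y + z • tw (simpleRefl j) • (x - c • tw v • y) := by
      rw [wordPhi_cons, mul_smul, ← hx, intertwiner, add_smul, one_smul, mul_smul, hw,
        List.map_cons, List.prod_cons, ← hv, map_mul, mul_smul (tw (simpleRefl j)) (tw v), smul_sub, smul_sub,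
        smul_comm (tw (simpleRefl j)) z, smul_comm (tw (simpleRefl j)) c, smul_smul z c]
      abel
    rw [h₁, List.length_cons]
    refine add_mem (add_mem (lowerSpan_mono (Nat.le_succ _) hmem) (Submodule.smul_mem _ _
      (Submodule.subset_span ⟨v, hGp, by omega, rfl⟩))) (Submodule.smul_mem _ _
      (smul_mem_lowerSpan hG.1 (fun u hu => ?_) hmem))
    have := length_simpleRefl_mul_le j u
    omega

/-- Letters are peeled off by applying `φ_j` again: `φ_j φ_j x = (1 - z²) x`, with `z ≠ ±1`. -/
theorem mem_of_wordPhi_smul_mem (hc : ∀ ξ η, tt ξ * tt η = tt η * tt ξ)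
    (hy : ∀ ξ, tt ξ • y = ζ ξ • y) {js : List (Fin N)} (hjs : ∀ j ∈ js, SatisfiesRefl tw tt j)
    (hred : IsReducedWord js)
    (hζ : ∀ a ∈ inversions (js.map simpleRefl).prod, ζ (coroot a) ≠ 1 ∧ ζ (coroot a) ≠ -1)
    {K : Submodule A M} (hK : wordPhi tw tt js • y ∈ K) : y ∈ K := by
  induction js with
  | nil => simpa using hK
  | cons j js ih =>
    rw [List.forall_mem_cons] at hjs
    rw [hred.inversions_cons] at hζ
    refine ih hjs.2 hred.of_cons (fun a ha => hζ a (Set.mem_insert_of_mem _ ha)) ?_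
    have hN : 1 < N := by
      refine (one_lt_or_eq_one (N := N)).resolve_right fun hN => ?_
      have h₁ : length (js.map simpleRefl).prod = js.length := hred.of_cons
      rw [IsReducedWord, List.map_cons, List.prod_cons, simpleRefl_eq_one hN, one_mul,
        List.length_cons] at hred
      omega
    have h₀ := hζ _ (Set.mem_insert _ _)
    rw [coroot_actR] at h₀
    have hw := tt_smul_wordPhi_smul hc hy hjs.2 (coroot (simpleRoot j))
    have h₁ := K.smul_mem (intertwiner tw tt j) hK
    rw [wordPhi_cons, mul_smul, ← mul_smul, hjs.1.intertwiner_mul_self hN, sub_smul, one_smul,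
      mul_smul, hw, smul_comm, hw, smul_smul] at h₁
    set z := ζ (actT ((js.map simpleRefl).prod)⁻¹ (coroot (simpleRoot j)))
    set x := wordPhi tw tt js • y
    have hz : 1 - z * z ≠ 0 := by
      intro h
      have : (1 - z) * (1 + z) = 0 := by linear_combination h
      rcases mul_eq_zero.1 this with h | h
      · exact h₀.1 (by linear_combination -h)
      · exact h₀.2 (by linear_combination h)
    have h₂ : (1 - z * z) • x ∈ K := by rwa [sub_smul, one_smul]
    have h₃ := K.smul_of_tower_mem (1 - z * z)⁻¹ h₂
    rwa [smul_smul, inv_mul_cancel₀ hz, one_smul] at h₃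

omit [NeZero N] in
/-- Vectors of pairwise different weights whose sum lies in a submodule lie in the submodule. -/
theorem mem_of_sum_mem {ι : Type} (s : Finset ι) (μ : ι → TPrime N → ℂ) (K : Submodule A M)
    (hμ : ∀ i ∈ s, ∀ j ∈ s, i ≠ j → ∃ ξ, μ i ξ ≠ μ j ξ) (v : ι → M)
    (hv : ∀ i ∈ s, ∀ ξ, tt ξ • v i = μ i ξ • v i) (hsum : ∑ i ∈ s, v i ∈ K) :
    ∀ i ∈ s, v i ∈ K := by
  classical
  induction s using Finset.induction_on generalizing v with
  | empty => simp
  | insert k s hk ih =>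
    simp only [Finset.forall_mem_insert] at hv
    have hs : ∀ i ∈ s, v i ∈ K := by
      intro i hi
      obtain ⟨ξ, hξ⟩ := hμ i (Finset.mem_insert_of_mem hi) k (Finset.mem_insert_self k s)
        (by rintro rfl; exact hk hi)
      -- `ξ - μ k ξ` kills `v k` and rescales the other vectors, `v i` by a nonzero factor since `ξ`
      -- separates `i` from `k`.
      have h₁ := K.sub_mem (K.smul_mem (tt ξ) hsum) (K.smul_of_tower_mem (μ k ξ) hsum)
      rw [Finset.sum_insert hk, smul_add, smul_add, hv.1, add_sub_add_left_eq_sub,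
        Finset.smul_sum, Finset.smul_sum, ← Finset.sum_sub_distrib] at h₁
      have h₂ := ih (fun i hi j hj => hμ i (Finset.mem_insert_of_mem hi) j
        (Finset.mem_insert_of_mem hj)) (fun i => tt ξ • v i - μ k ξ • v i)
        (fun i hi η => by
          rw [hv.2 i hi, ← sub_smul, smul_comm, hv.2 i hi, smul_comm]) h₁ i hi
      rw [hv.2 i hi, ← sub_smul] at h₂
      have h₃ := K.smul_of_tower_mem (μ i ξ - μ k ξ)⁻¹ h₂
      rwa [smul_smul, inv_mul_cancel₀ (sub_ne_zero.2 hξ), one_smul] at h₃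
    rw [Finset.forall_mem_insert]
    refine ⟨?_, hs⟩
    rw [Finset.sum_insert hk] at hsum
    exact (K.add_mem_iff_left (K.sum_mem hs)).1 hsum

end Realization

/-! ### Basis and irreducibility for generic weights -/

section InducedFamily

variable {N : ℕ} [NeZero N] {A : Type} [Ring A] [Algebra ℂ A] {β : Composition N}
  {G : Subgroup (AffW N)} {tw : AffW N →* A} {tt : TPrime N →ₗ[ℂ] A}
  {M : Type} [AddCommGroup M] [Module ℂ M] [Module A M]
  {ζ : Module.Dual ℂ (TPrime N)} {y : M} {ι : Type} {r : ι → AffW N} {vec : ι → M}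

/-- The module `M` is generated by a vector `y` of generic weight `ζ` which is fixed by the
parabolic subgroup, the cosets of the latter in `G` are separated by linear forms, and the vectors
`vec i` are the `φ_w y` for the minimal representatives `w = r i` of these cosets. -/
structure IsInducedFamily (β : Composition N) (G : Subgroup (AffW N)) (tw : AffW N →* A)
    (tt : TPrime N →ₗ[ℂ] A) (ζ : Module.Dual ℂ (TPrime N)) (y : M) (r : ι → AffW N)
    (vec : ι → M) : Prop extends IsRealization β G tw tt where
  weight : ∀ ξ, tt ξ • y = ζ ξ • y
  fixed : ∀ u ∈ parabolic β, tw (fin u) • y = y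
  gen : ∀ x : M, ∃ a : A, a • y = x
  injective : Function.Injective r
  mem : ∀ i, r i ∈ G
  mem_cosetReps : ∀ i, r i ∈ cosetReps β
  surjective : ∀ w ∈ G, w ∈ cosetReps β → ∃ i, r i = w
  vec_eq : ∀ i, ∃ e, IsReducedExpr (r i) e ∧
    vec i = tw (piElt N ^ e.1) • wordPhi tw tt e.2 • y
  generic : ∀ i, ∀ a ∈ inversions (r i), ζ (coroot a) ∉ ({1, 0, -1} : Set ℂ)
  form : ∀ i, ∃ f : M →ₗ[ℂ] ℂ, f (tw (r i) • y) = 1 ∧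
    ∀ v ∈ G, (¬ ∃ u ∈ parabolic β, v = r i * fin u) → f (tw v • y) = 0

namespace IsInducedFamily

variable [IsScalarTower ℂ A M]

theorem vec_sub_mem (h : IsInducedFamily β G tw tt ζ y r vec) (i : ι) :
    ∃ c : ℂ, c ≠ 0 ∧ vec i - c • tw (r i) • y ∈ lowerSpan G tw y (length (r i)) := by
  obtain ⟨e, he, hv⟩ := h.vec_eq i
  obtain ⟨c, hc, hmem⟩ := wordPhi_smul_sub_mem h.comm h.weight (h.refl _ (h.mem i) e he)
    (h.refl_mem _ (h.mem i) e he) he.isReducedWord fun a ha => fun h₀ => by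
      rw [← he.inversions_eq] at ha
      exact h.generic i a ha (by simp [h₀])
  refine ⟨c, hc, ?_⟩
  have := smul_mem_lowerSpan (h.pi_mem _ (h.mem i) e he) (n := length (r i)) (fun u hu => by
    rwa [length_piElt_zpow_mul, ← he.2]) hmem
  rwa [smul_sub, smul_comm _ c, ← mul_smul (tw _) (tw _), ← map_mul, ← he.1, ← hv] at this

/-- Since `W_β` fixes `y`, `w` may be replaced by its minimal representative, whose vector is a
multiple of the corresponding `vec i` up to shorter terms; induct on length. -/
theorem tw_smul_mem_span (h : IsInducedFamily β G tw tt ζ y r vec) {w : AffW N} (hw : w ∈ G) :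
    tw w • y ∈ Submodule.span ℂ (Set.range vec) := by
  induction hn : length w using Nat.strong_induction_on generalizing w with
  | _ n ih =>
    obtain ⟨u, hu, hmin, hle⟩ := exists_mem_cosetReps β w
    obtain ⟨i, hi⟩ := h.surjective _ (mul_mem hw (h.fin_mem u hu)) hmin
    have h₁ : tw w • y = tw (r i) • y := by
      rw [hi, map_mul, mul_smul, h.fixed u hu]
    obtain ⟨c, hc, hmem⟩ := h.vec_sub_mem i
    have h₂ : lowerSpan G tw y (length (r i)) ≤ Submodule.span ℂ (Set.range vec) := by
      refine Submodule.span_le.2 ?_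
      rintro _ ⟨v, hv, hl, rfl⟩
      rw [hi] at hl
      exact ih _ (by omega) hv rfl
    have h₃ : c • tw (r i) • y ∈ Submodule.span ℂ (Set.range vec) := by
      have := sub_mem (Submodule.subset_span (Set.mem_range_self i)) (h₂ hmem)
      rwa [sub_sub_cancel] at this
    have h₄ := Submodule.smul_mem _ c⁻¹ h₃
    rwa [smul_smul, inv_mul_cancel₀ hc, one_smul, ← h₁] at h₄

/-- `ξ` is pushed through a reduced expression until it meets the weight vector `y`; each
commutation leaves only a shorter word, still in `G`. -/
theorem tt_smul_tw_smul_mem (h : IsInducedFamily β G tw tt ζ y r vec) {w : AffW N} (hw : w ∈ G)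
    (ξ : TPrime N) : tt ξ • tw w • y ∈ Submodule.span ℂ {x | ∃ u ∈ G, x = tw u • y} := by
  have hG : ∀ g ∈ G, ∀ x ∈ Submodule.span ℂ {x | ∃ u ∈ G, x = tw u • y},
      tw g • x ∈ Submodule.span ℂ {x | ∃ u ∈ G, x = tw u • y} := by
    intro g hg x hx
    induction hx using Submodule.span_induction with
    | mem x hx =>
      obtain ⟨u, hu, rfl⟩ := hx
      exact Submodule.subset_span ⟨g * u, mul_mem hg hu, by rw [map_mul, mul_smul]⟩
    | zero => simp
    | add x z _ _ hx hz => rw [smul_add]; exact add_mem hx hz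
    | smul a x _ hx => rw [smul_comm]; exact Submodule.smul_mem _ _ hx
  obtain ⟨e, he⟩ := exists_isReducedExpr w
  have hword : ∀ js : List (Fin N), (∀ j ∈ js, SatisfiesRefl tw tt j) →
      (∀ j ∈ js, simpleRefl j ∈ G) → ∀ ξ, tt ξ • tw (js.map simpleRefl).prod • y ∈
        Submodule.span ℂ {x | ∃ u ∈ G, x = tw u • y} := by
    intro js
    induction js with
    | nil =>
      intro _ _ ξ
      rw [List.map_nil, List.prod_nil, map_one, one_smul, h.weight]
      exact Submodule.smul_mem _ _ (Submodule.subset_span ⟨1, one_mem _, by simp⟩)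
    | cons j js ih =>
      intro h₁ h₂ ξ
      rw [List.forall_mem_cons] at h₁ h₂
      rw [List.map_cons, List.prod_cons, map_mul, mul_smul, ← mul_smul (tt ξ), h₁.1.tt_mul,
        sub_smul, mul_smul, algebraMap_smul]
      refine sub_mem (hG _ h₂.1 _ (ih h₁.2 h₂.2 _)) (Submodule.smul_mem _ _
        (Submodule.subset_span ⟨_, list_prod_mem fun x hx => ?_, rfl⟩))
      obtain ⟨i, hi, rfl⟩ := List.mem_map.1 hx
      exact h₂.2 i hi
  have hpi := h.pi w hw e he (actT (piElt N ^ e.1)⁻¹ ξ)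
  rw [actT_actT_inv] at hpi
  rw [he.1, map_mul, mul_smul, ← mul_smul (tt ξ), ← hpi, mul_smul]
  exact hG _ (h.pi_mem w hw e he) _ (hword _ (h.refl w hw e he) (h.refl_mem w hw e he) _)

theorem span_tw_smul (h : IsInducedFamily β G tw tt ζ y r vec) :
    Submodule.span ℂ {x | ∃ u ∈ G, x = tw u • y} = ⊤ := by
  have key : ∀ a ∈ Algebra.adjoin ℂ (tw '' G ∪ Set.range tt),
      ∀ x ∈ Submodule.span ℂ {x | ∃ u ∈ G, x = tw u • y},
        a • x ∈ Submodule.span ℂ {x | ∃ u ∈ G, x = tw u • y} := by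
    intro a ha
    induction ha using Algebra.adjoin_induction with
    | mem a ha =>
      intro x hx
      induction hx using Submodule.span_induction with
      | mem x hx =>
        obtain ⟨u, hu, rfl⟩ := hx
        rcases ha with ⟨g, hg, rfl⟩ | ⟨ξ, rfl⟩
        · exact Submodule.subset_span ⟨g * u, mul_mem hg hu, by rw [map_mul, mul_smul]⟩
        · exact h.tt_smul_tw_smul_mem hu ξ
      | zero => simp
      | add x z _ _ hx hz => rw [smul_add]; exact add_mem hx hz
      | smul a x _ hx => rw [smul_comm]; exact Submodule.smul_mem _ _ hx
    | algebraMap c =>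
      intro x hx
      rw [algebraMap_smul]
      exact Submodule.smul_mem _ _ hx
    | add a b _ _ ha hb =>
      intro x hx
      rw [add_smul]
      exact add_mem (ha x hx) (hb x hx)
    | mul a b _ _ ha hb =>
      intro x hx
      rw [mul_smul]
      exact ha _ (hb x hx)
  refine eq_top_iff.2 fun x _ => ?_
  obtain ⟨a, rfl⟩ := h.gen x
  exact key a (h.adjoin ▸ Algebra.mem_top) y
    (Submodule.subset_span ⟨1, one_mem _, by simp⟩)

theorem span_vec (h : IsInducedFamily β G tw tt ζ y r vec) :
    Submodule.span ℂ (Set.range vec) = ⊤ := by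
  rw [eq_top_iff, ← h.span_tw_smul, Submodule.span_le]
  rintro _ ⟨u, hu, rfl⟩
  exact h.tw_smul_mem_span hu

theorem linearIndependent (h : IsInducedFamily β G tw tt ζ y r vec) :
    LinearIndependent ℂ vec := by
  classical
  rw [linearIndependent_iff']
  intro s g hsum
  by_contra! hne
  obtain ⟨i₀, hi₀, hg₀⟩ := hne
  -- At maximal length the form of the coset of `r i` sees only `vec i`: shorter elements avoid that
  -- coset because `r i` is minimal, and other representatives do by uniqueness.
  obtain ⟨i, hi, hmax⟩ := Finset.exists_max_image (s.filter fun i => g i ≠ 0)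
    (fun i => length (r i)) ⟨i₀, Finset.mem_filter.2 ⟨hi₀, hg₀⟩⟩
  rw [Finset.mem_filter] at hi
  obtain ⟨f, hf₁, hf₀⟩ := h.form i
  have hlow : ∀ n ≤ length (r i), ∀ x ∈ lowerSpan G tw y n, f x = 0 := by
    intro n hn x hx
    suffices lowerSpan G tw y n ≤ LinearMap.ker f from this hx
    refine Submodule.span_le.2 ?_
    rintro _ ⟨v, hv, hl, rfl⟩
    refine hf₀ v hv ?_
    rintro ⟨u, hu, rfl⟩
    have := h.mem_cosetReps i u hu
    omega
  obtain ⟨c, hc, hmem⟩ := h.vec_sub_mem i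
  have hfi : f (vec i) = c := by
    have := hlow _ le_rfl _ hmem
    rwa [map_sub, map_smul, hf₁, smul_eq_mul, mul_one, sub_eq_zero] at this
  have hfj : ∀ j ∈ s, j ≠ i → g j • f (vec j) = 0 := by
    intro j hj hji
    by_cases hgj : g j = 0
    · rw [hgj, zero_smul]
    · obtain ⟨d, -, hmem⟩ := h.vec_sub_mem j
      have := hlow _ (hmax j (Finset.mem_filter.2 ⟨hj, hgj⟩)) _ hmem
      rw [map_sub, map_smul, hf₀ (r j) (h.mem j), smul_zero, sub_zero] at this
      · rw [this, smul_zero]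
      · rintro ⟨u, hu, hr⟩
        have hu₁ := cosetReps_unique (h.mem_cosetReps i) hu (hr ▸ h.mem_cosetReps j)
        rw [hu₁, fin_one, mul_one] at hr
        exact hji (h.injective hr)
  have := congrArg f hsum
  rw [map_sum, map_zero, Finset.sum_eq_single i (fun j hj hji => by rw [map_smul, hfj j hj hji])
    (fun hni => absurd hi.1 hni), map_smul, hfi, smul_eq_mul] at this
  exact mul_ne_zero hi.2 hc this

theorem isBasis (h : IsInducedFamily β G tw tt ζ y r vec) : IsBasis vec :=
  ⟨h.linearIndependent, h.span_vec⟩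

theorem tt_smul_vec (h : IsInducedFamily β G tw tt ζ y r vec) (i : ι) (ξ : TPrime N) :
    tt ξ • vec i = ζ (actT (r i)⁻¹ ξ) • vec i := by
  obtain ⟨e, he, hv⟩ := h.vec_eq i
  have hpi := h.pi _ (h.mem i) e he (actT (piElt N ^ e.1)⁻¹ ξ)
  rw [actT_actT_inv] at hpi
  rw [hv, ← mul_smul (tt ξ), ← hpi, mul_smul, tt_smul_wordPhi_smul h.comm h.weight
    (h.refl _ (h.mem i) e he), smul_comm _ (ζ _), ← actT_mul, ← mul_inv_rev, ← he.1]

-- Equal weights make `x = (r i)⁻¹ * r j` fix `ζ`. An inversion `a` of `x` with `ζ(a) = 0` is either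
-- inverted by `r j`, or else `-x(a)` is inverted by `r i`; genericity forbids both.
omit [IsScalarTower ℂ A M] in
theorem exists_weight_ne (h : IsInducedFamily β G tw tt ζ y r vec)
    (hstab : ∀ x ∈ G, x ≠ 1 → (∀ ξ, ζ (actT x ξ) = ζ ξ) →
      ∃ a ∈ inversions x, ζ (coroot a) = 0) {i j : ι} (hij : i ≠ j) :
    ∃ ξ, ζ (actT (r i)⁻¹ ξ) ≠ ζ (actT (r j)⁻¹ ξ) := by
  by_contra! heq
  have hstab' : ∀ ξ, ζ (actT ((r i)⁻¹ * r j) ξ) = ζ ξ := fun ξ => by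
    rw [actT_mul, heq, actT_inv_actT]
  obtain ⟨a, ha, hζ⟩ := hstab ((r i)⁻¹ * r j) (mul_mem (inv_mem (h.mem i)) (h.mem j))
    (fun h₁ => hij (h.injective (inv_mul_eq_one.1 h₁))) hstab'
  obtain ⟨h₁, h₂, h₃⟩ := mem_inversions_iff.1 ha
  have h₄ : 0 < ht (actR (r j) a) := by
    refine lt_of_le_of_ne (not_lt.1 fun hlt => ?_) (ht_ne_zero (actR_mem_roots h₁)).symm
    exact h.generic j a (mem_inversions_iff.2 ⟨h₁, h₂, hlt⟩) (by simp [hζ])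
  refine h.generic i (-actR ((r i)⁻¹ * r j) a) (mem_inversions_iff.2
    ⟨neg_mem_roots (actR_mem_roots h₁), by rw [map_neg]; omega, ?_⟩) ?_
  · rw [actR_neg, map_neg, ← actR_mul, mul_inv_cancel_left]
    omega
  · rw [coroot_neg, map_neg, coroot_actR, hstab', hζ]
    simp

theorem isSimpleModule (h : IsInducedFamily β G tw tt ζ y r vec)
    (hstab : ∀ x ∈ G, x ≠ 1 → (∀ ξ, ζ (actT x ξ) = ζ ξ) →
      ∃ a ∈ inversions x, ζ (coroot a) = 0) : IsSimpleModule A M := by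
  classical
  have hy : y ≠ 0 := by
    obtain ⟨u, hu, hmin, -⟩ := exists_mem_cosetReps β (1 : AffW N)
    obtain ⟨i, hi⟩ := h.surjective _ (mul_mem (one_mem _) (h.fin_mem u hu)) hmin
    obtain ⟨f, hf, -⟩ := h.form i
    rintro rfl
    simp at hf
  have : Nontrivial M := ⟨y, 0, hy⟩
  rw [isSimpleModule_iff]
  refine ⟨fun K => or_iff_not_imp_left.2 fun hK => ?_⟩
  obtain ⟨x, hxK, hx⟩ := K.ne_bot_iff.1 hK
  obtain ⟨g, hg⟩ := (Finsupp.mem_span_range_iff_exists_finsupp).1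
    (h.span_vec ▸ Submodule.mem_top : x ∈ Submodule.span ℂ (Set.range vec))
  have hg₀ : g ≠ 0 := by
    rintro rfl
    exact hx (by simpa using hg.symm)
  obtain ⟨i, hi⟩ := Finsupp.support_nonempty_iff.2 hg₀
  have h₁ := mem_of_sum_mem g.support (fun i ξ => ζ (actT (r i)⁻¹ ξ)) K
    (fun i _ j _ hij => h.exists_weight_ne hstab hij) (fun i => g i • vec i)
    (fun i _ ξ => by rw [smul_comm, h.tt_smul_vec, smul_comm]) (by rw [← hg] at hxK; exact hxK) i hi
  have h₂ : vec i ∈ K := by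
    have := K.smul_of_tower_mem (g i)⁻¹ h₁
    rwa [smul_smul, inv_mul_cancel₀ (Finsupp.mem_support_iff.1 hi), one_smul] at this
  obtain ⟨e, he, hv⟩ := h.vec_eq i
  have h₃ := K.smul_mem (tw (piElt N ^ e.1)⁻¹) h₂
  rw [hv, ← mul_smul, ← map_mul, inv_mul_cancel, map_one, one_smul] at h₃
  have h₄ : y ∈ K := mem_of_wordPhi_smul_mem h.comm h.weight (h.refl _ (h.mem i) e he)
    he.isReducedWord (fun a ha => by
      rw [← he.inversions_eq] at ha
      have := h.generic i a ha
      simp only [Set.mem_insert_iff, Set.mem_singleton_iff, not_or] at this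
      exact ⟨this.1, this.2.2⟩) h₃
  refine eq_top_iff.2 fun z _ => ?_
  obtain ⟨a, rfl⟩ := h.gen z
  exact K.smul_mem a h₄

end IsInducedFamily

end InducedFamily

/-! ### Stabilizers of weights -/

section Stabilizers

variable {N : ℕ} {ζ : Module.Dual ℂ (TPrime N)}

theorem apply_coroot_root (i j : Fin N) (k : ℤ) :
    ζ (coroot (root i j k)) = ζ (Pi.single i 1, 0) - ζ (Pi.single j 1, 0) + k * ζ (central N) := by
  have : coroot (root i j k) = (Pi.single i 1, 0) - (Pi.single j 1, 0) + (k : ℂ) • central N := by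
    refine Prod.ext (funext fun l => ?_) ?_ <;>
      simp [coroot, root, eps, central, Pi.single_apply]
  rw [this, map_add, map_sub, map_smul, smul_eq_mul]

theorem actT_single (x : AffW N) (j : Fin N) :
    actT x (Pi.single j 1, 0) =
      (Pi.single (x.right j) 1, 0) - (shift x (x.right j) : ℂ) • central N := by
  rw [actT_eq]
  refine Prod.ext (funext fun l => ?_) ?_
  · simp [central, Pi.single_apply, Equiv.symm_apply_eq]
  · simp [central, Pi.single_apply]

/-- If the heights in the orbit of a root orthogonal to a fixed weight sum up to zero, then a root
in the orbit, or its negative, is inverted. -/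
theorem exists_inversion_of_sum_ht {x : AffW N} (hfix : ∀ ξ, ζ (actT x ξ) = ζ ξ)
    {a : RootLattice N} (ha : a ∈ roots N) (hζ : ζ (coroot a) = 0) {n : ℕ} (hn : 0 < n)
    (hsum : ∑ m ∈ Finset.range n, ht (actR (x ^ m) a) = 0) :
    ∃ b ∈ inversions x, ζ (coroot b) = 0 := by
  wlog hpos : 0 < ht a generalizing a
  · refine this (neg_mem_roots ha) (by rw [coroot_neg, map_neg, hζ, neg_zero]) ?_ ?_
    · simp only [actR_neg, map_neg, Finset.sum_neg_distrib, hsum, neg_zero]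
    · have := ht_ne_zero ha
      rw [map_neg]
      omega
  by_contra! hno
  -- Without such an inversion the orbit of a positive root would stay positive, and the heights
  -- could not sum to zero.
  have key : ∀ m : ℕ, 0 < ht (actR (x ^ m) a) ∧ ζ (coroot (actR (x ^ m) a)) = 0 := by
    intro m
    induction m with
    | zero => simpa using ⟨hpos, hζ⟩
    | succ m ih =>
      have hr := actR_mem_roots (w := x ^ m) ha
      have h₁ : ht (actR x (actR (x ^ m) a)) ≠ 0 := ht_ne_zero (actR_mem_roots hr)
      have h₂ : ¬ ht (actR x (actR (x ^ m) a)) < 0 := fun hlt =>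
        hno _ (mem_inversions_iff.2 ⟨hr, ih.1, hlt⟩) ih.2
      rw [pow_succ', actR_mul, coroot_actR, hfix]
      exact ⟨by omega, ih.2⟩
  have := Finset.sum_pos (fun m (_ : m ∈ Finset.range n) => (key m).1)
    (Finset.nonempty_range_iff.2 hn.ne')
  omega

theorem exists_inversion_of_fixed {x : AffW N} (hx : x ≠ 1) (hfix : ∀ ξ, ζ (actT x ξ) = ζ ξ)
    (hlevel : ζ (central N) ≠ 0 ∨ ∃ τ, x = fin τ) : ∃ a ∈ inversions x, ζ (coroot a) = 0 := by
  have hs : ∀ j, ζ (Pi.single (x.right j) 1, 0) - shift x (x.right j) * ζ (central N) =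
      ζ (Pi.single j 1, 0) := fun j => by
    rw [← hfix (Pi.single j 1, 0), actT_single, map_sub, map_smul, smul_eq_mul]
  obtain ⟨i, hi⟩ : ∃ i, x.right i ≠ i := by
    by_contra! hall
    have hr : x.right = 1 := Equiv.ext hall
    refine hx (affW_ext hr fun j => ?_)
    rcases hlevel with hc | ⟨τ, rfl⟩
    · have := hs j
      rw [hr, Equiv.Perm.one_apply, sub_eq_self, mul_eq_zero] at this
      simpa [hc] using this
    · simp
  -- With this `k`, invariance of `ζ` at `ε_i^∨` says exactly that `ε_i - ε_{x(i)} + k δ` is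
  -- orthogonal to `ζ`. Its finite part telescopes to zero along the orbit.
  set k := shift x (x.right i) with hk
  have hpow : ∀ m : ℕ, (x ^ m).right = x.right ^ m := fun m =>
    map_pow SemidirectProduct.rightHom x m
  have hζ : ζ (coroot (root i (x.right i) k)) = 0 := by
    rw [apply_coroot_root, ← hs i]
    ring
  set n := orderOf x.right
  have hn : 0 < n := orderOf_pos _
  have hfst : (∑ m ∈ Finset.range n, actR (x ^ m) (root i (x.right i) k)).1 = 0 := by
    have hm : ∀ m : ℕ, (actR (x ^ m) (root i (x.right i) k)).1 =
        eps ((x.right ^ m) i) - eps ((x.right ^ (m + 1)) i) := fun m => by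
      rw [actR_root, hpow, pow_succ, Equiv.Perm.mul_apply]
      rfl
    rw [Prod.fst_sum, Finset.sum_congr rfl fun m _ => hm m,
      Finset.sum_range_sub' (fun m => (eps ((x.right ^ m) i) : Fin N → ℤ)), pow_orderOf_eq_one]
    simp
  -- The orbit sum is a multiple of `δ` orthogonal to `ζ`, hence zero at nonzero level. For a finite
  -- `x` every term has `δ`-coefficient `k = 0`.
  have hsnd : (∑ m ∈ Finset.range n, actR (x ^ m) (root i (x.right i) k)).2 = 0 := by
    rcases hlevel with hc | ⟨τ, rfl⟩
    · have hfix' : ∀ (m : ℕ) ξ, ζ (actT (x ^ m) ξ) = ζ ξ := fun m => by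
        induction m with
        | zero => simp
        | succ m ih => intro ξ; rw [pow_succ, actT_mul, ih, hfix]
      have h₁ : ζ (coroot (∑ m ∈ Finset.range n, actR (x ^ m) (root i (x.right i) k))) = 0 := by
        rw [show ∀ s : Finset ℕ, ∀ f : ℕ → RootLattice N, coroot (∑ m ∈ s, f m) =
          ∑ m ∈ s, coroot (f m) from fun s f => map_sum (AddMonoidHom.mk' coroot coroot_add) f s,
          map_sum]
        exact Finset.sum_eq_zero fun m _ => by rw [coroot_actR, hfix', hζ]
      generalize ∑ m ∈ Finset.range n, actR (x ^ m) (root i (x.right i) k) = b at hfst h₁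
      have h₂ : coroot b = (b.2 : ℂ) • central N := by
        refine Prod.ext (funext fun l => ?_) ?_ <;> simp [coroot, central, hfst]
      rw [h₂, map_smul, smul_eq_mul, mul_eq_zero, or_iff_left hc] at h₁
      exact_mod_cast h₁
    · rw [Prod.snd_sum]
      refine Finset.sum_eq_zero fun m _ => ?_
      rw [show fin τ ^ m = fin (τ ^ m) from (map_pow SemidirectProduct.inr τ m).symm, actR_fin_snd]
      simp [root, hk]
  refine exists_inversion_of_sum_ht hfix ⟨_, _, k, hi.symm, rfl⟩ hζ hn ?_
  rw [← map_sum, ht_apply, hfst, hsnd]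
  simp

end Stabilizers

/-! ### Induced modules -/

section InducedModule

variable {A : Type} [Ring A] [Algebra ℂ A] {B : Subalgebra ℂ A} (χ : B →ₐ[ℂ] ℂ)

theorem smul_cyclicVector (b : B) : (b : A) • cyclicVector χ = χ b • cyclicVector χ := by
  have : (b : A) ⊗ₜ[ℂ] (1 : ℂ) - (1 : A) ⊗ₜ[ℂ] (χ b) ∈ balancing χ :=
    Submodule.subset_span ⟨1, b, 1, by simp⟩
  have h := (Submodule.Quotient.eq _).2 this
  have h₁ : (b : A) • cyclicVector χ = Submodule.Quotient.mk ((b : A) ⊗ₜ[ℂ] (1 : ℂ)) := by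
    rw [cyclicVector, ← Submodule.Quotient.mk_smul, TensorProduct.smul_tmul', smul_eq_mul, mul_one]
  have h₂ : χ b • cyclicVector χ = Submodule.Quotient.mk ((1 : A) ⊗ₜ[ℂ] χ b) := by
    rw [cyclicVector, ← Submodule.Quotient.mk_smul, ← TensorProduct.tmul_smul, smul_eq_mul,
      mul_one]
  rw [h₁, h₂, h]

theorem exists_smul_cyclicVector (x : Induced χ) : ∃ a : A, a • cyclicVector χ = x := by
  obtain ⟨t, rfl⟩ := Submodule.Quotient.mk_surjective _ x
  obtain ⟨a, rfl⟩ := (TensorProduct.rid ℂ A).symm.surjective t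
  refine ⟨a, ?_⟩
  rw [cyclicVector, ← Submodule.Quotient.mk_smul, TensorProduct.smul_tmul', smul_eq_mul, mul_one,
    TensorProduct.rid_symm_apply]

variable {χ}

theorem exists_inducedForm (L : A →ₗ[ℂ] ℂ) (hL : ∀ (a : A) (b : B), L (a * b) = χ b * L a) :
    ∃ f : Induced χ →ₗ[ℂ] ℂ, ∀ a : A, f (a • cyclicVector χ) = L a := by
  let f₀ : A ⊗[ℂ] ℂ →ₗ[ℂ] ℂ := L ∘ₗ (TensorProduct.rid ℂ A).toLinearMap
  have hf₀ : ∀ (a : A) (z : ℂ), f₀ (a ⊗ₜ z) = z * L a := fun a z => by simp [f₀]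
  -- `f₀` is only `ℂ`-linear while `balancing χ` is an `A`-span, so the claim is strengthened to all
  -- multiples `a • x`.
  have hker : ∀ x ∈ balancing χ, ∀ a : A, f₀ (a • x) = 0 := by
    intro x hx
    induction hx using Submodule.span_induction with
    | mem x hx =>
      obtain ⟨a', b, z, rfl⟩ := hx
      intro a
      rw [smul_sub, TensorProduct.smul_tmul', TensorProduct.smul_tmul', smul_eq_mul, smul_eq_mul,
        map_sub, hf₀, hf₀, ← mul_assoc, hL]
      ring
    | zero => simp
    | add x y _ _ hx hy =>
      intro a
      rw [smul_add, map_add, hx, hy, add_zero]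
    | smul b x _ hx =>
      intro a
      rw [← mul_smul, hx]
  refine ⟨(((balancing χ).restrictScalars ℂ).liftQ f₀ fun x hx => by
      simpa using hker x hx 1) ∘ₗ
        (Submodule.Quotient.restrictScalarsEquiv ℂ (balancing χ)).symm.toLinearMap, fun a => ?_⟩
  rw [cyclicVector, ← Submodule.Quotient.mk_smul, TensorProduct.smul_tmul', smul_eq_mul, mul_one,
    LinearMap.comp_apply, LinearEquiv.coe_coe, Submodule.Quotient.restrictScalarsEquiv_symm_mk,
    Submodule.liftQ_apply, hf₀, one_mul]

end InducedModule

/-! ### The generators of `H` -/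

section Generators

variable {N : ℕ} [NeZero N]

variable (N) in
/-- The homomorphism from `W` to `H`. -/
noncomputable def ofWHom : AffW N →* H N where
  toFun := ofW
  map_one' := (RingQuot.mkAlgHom_rel ℂ Rel.one).trans (map_one _)
  map_mul' v w := (RingQuot.mkAlgHom_rel ℂ (Rel.mul v w)).trans (map_mul _ _ _)

variable (N) in
/-- The linear map from `𝔱'` to `H`. -/
noncomputable def ofTLin : TPrime N →ₗ[ℂ] H N where
  toFun := ofT
  map_add' ξ η := (RingQuot.mkAlgHom_rel ℂ (Rel.add ξ η)).trans (map_add _ _ _)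
  map_smul' a ξ := (RingQuot.mkAlgHom_rel ℂ (Rel.smul a ξ)).trans (map_smul _ _ _)

theorem ofT_comm (ξ η : TPrime N) : ofT ξ * ofT η = ofT η * ofT ξ := by
  have h := RingQuot.mkAlgHom_rel ℂ (Rel.comm ξ η)
  rw [map_mul, map_mul] at h
  exact h

theorem satisfiesRefl_ofW (j : Fin N) : SatisfiesRefl (ofWHom N) (ofTLin N) j := fun ξ => by
  have h := RingQuot.mkAlgHom_rel ℂ (Rel.refl j ξ)
  rw [AlgHom.commutes, map_sub, map_mul, map_mul] at h
  exact h

theorem ofW_piElt_mul (ξ : TPrime N) :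
    ofW (piElt N) * ofT ξ = ofT (actT (piElt N) ξ) * ofW (piElt N) := by
  have h := RingQuot.mkAlgHom_rel ℂ (Rel.pi ξ)
  rw [map_mul, map_mul] at h
  exact h

theorem ofW_piElt_zpow_mul (k : ℤ) (ξ : TPrime N) :
    ofWHom N (piElt N ^ k) * ofTLin N ξ =
      ofTLin N (actT (piElt N ^ k) ξ) * ofWHom N (piElt N ^ k) := by
  induction k using Int.induction_on generalizing ξ with
  | zero => simp
  | succ n ih =>
    have h : ofWHom N (piElt N) * ofTLin N ξ = ofTLin N (actT (piElt N) ξ) * ofWHom N (piElt N) :=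
      ofW_piElt_mul ξ
    rw [zpow_add_one, map_mul, mul_assoc, h, ← mul_assoc, ih, actT_mul, mul_assoc]
  | pred n ih =>
    have h : ofWHom N (piElt N) * ofTLin N (actT (piElt N)⁻¹ ξ) =
        ofTLin N ξ * ofWHom N (piElt N) := by
      have h := ofW_piElt_mul (actT (piElt N)⁻¹ ξ)
      rw [actT_actT_inv] at h
      exact h
    have h' : ofWHom N (piElt N)⁻¹ * ofTLin N ξ =
        ofTLin N (actT (piElt N)⁻¹ ξ) * ofWHom N (piElt N)⁻¹ := by
      have h₁ : ofWHom N (piElt N)⁻¹ * ofWHom N (piElt N) = 1 := by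
        rw [← map_mul, inv_mul_cancel, map_one]
      have h₂ : ofWHom N (piElt N) * ofWHom N (piElt N)⁻¹ = 1 := by
        rw [← map_mul, mul_inv_cancel, map_one]
      calc _ = ofWHom N (piElt N)⁻¹ * (ofTLin N ξ * ofWHom N (piElt N)) *
            ofWHom N (piElt N)⁻¹ := by rw [mul_assoc, mul_assoc, h₂, mul_one]
        _ = _ := by rw [← h, ← mul_assoc, h₁, one_mul]
    rw [zpow_sub_one, map_mul, mul_assoc, h', ← mul_assoc, ih, actT_mul, mul_assoc]

theorem isRealization_H (β : Composition N) :
    IsRealization β ⊤ (ofWHom N) (ofTLin N) where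
  comm := ofT_comm
  refl_mem _ _ _ _ _ _ := trivial
  refl _ _ _ _ j _ := satisfiesRefl_ofW j
  pi_mem _ _ _ _ := trivial
  pi _ _ e _ ξ := ofW_piElt_zpow_mul e.1 ξ
  fin_mem _ _ := trivial
  adjoin := by
    refine eq_top_iff.2 fun x hx => ?_
    clear hx
    induction x using H_induction with
    | ofW w => exact Algebra.subset_adjoin (Or.inl ⟨w, trivial, rfl⟩)
    | ofT ξ => exact Algebra.subset_adjoin (Or.inr ⟨ξ, rfl⟩)
    | algebraMap c => exact Subalgebra.algebraMap_mem _ c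
    | add x y hx hy => exact add_mem hx hy
    | mul x y hx hy => exact mul_mem hx hy

/-- Some reduced expression realizing `phi w` suffices below, so the braid relations for the `φ_i`
are never used. -/
theorem phi_eq (w : AffW N) : ∃ e, IsReducedExpr w e ∧
    phi w = ofWHom N (piElt N ^ e.1) * wordPhi (ofWHom N) (ofTLin N) e.2 := by
  have h := exists_isReducedExpr w
  refine ⟨h.choose, h.choose_spec, ?_⟩
  rw [phi, dif_pos h]
  rfl

variable {β : Composition N}

theorem isInducedFamily_H {ζ : Module.Dual ℂ (TPrime N)} (hζ : ζ ∈ weights β)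
    (hgen : IsGeneric β ζ) :
    IsInducedFamily β ⊤ (ofWHom N) (ofTLin N) ζ (cyclicVector (parabolicChar hζ))
      (fun w : cosetReps β => (w : AffW N))
      (fun w : cosetReps β => phi (w : AffW N) • cyclicVector (parabolicChar hζ)) where
  toIsRealization := isRealization_H β
  weight ξ := by
    have hmem : ofT ξ ∈ parabolicH β := Algebra.subset_adjoin (Or.inr ⟨ξ, rfl⟩)
    have := smul_cyclicVector (parabolicChar hζ) ⟨ofT ξ, hmem⟩
    rwa [(parabolicChar_isCharacter hζ).2 _ ξ rfl] at this
  fixed u hu := by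
    have hmem : ofW (fin u) ∈ parabolicH β := Algebra.subset_adjoin (Or.inl ⟨u, hu, rfl⟩)
    have := smul_cyclicVector (parabolicChar hζ) ⟨ofW (fin u), hmem⟩
    rwa [(parabolicChar_isCharacter hζ).1 _ u hu rfl, one_smul] at this
  gen := exists_smul_cyclicVector _
  injective := Subtype.val_injective
  mem _ := trivial
  mem_cosetReps w := w.2
  surjective w _ hw := ⟨⟨w, hw⟩, rfl⟩
  vec_eq w := by
    obtain ⟨e, he, hphi⟩ := phi_eq (w : AffW N)
    exact ⟨e, he, by rw [hphi, mul_smul]⟩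
  generic w := hgen w w.2
  form w := by
    obtain ⟨f, hf⟩ := exists_inducedForm (χ := parabolicChar hζ)
      ((cosetForm β (w : AffW N)).comp ((LinearMap.applyₗ (Finsupp.single 1 1)).comp
        (principal ζ).toLinearMap)) (cosetForm_principal_mul hζ w)
    have hf' : ∀ v, f (ofWHom N v • cyclicVector (parabolicChar hζ)) =
        cosetForm β (w : AffW N) (Finsupp.single v 1) := fun v => by
      rw [hf]
      change cosetForm β _ (principal ζ (ofW v) _) = _
      rw [principal_ofW, leftMul_single, mul_one]
    refine ⟨f, ?_, fun v _ hv => ?_⟩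
    · rw [hf', cosetForm_single, if_pos ⟨1, one_mem _, by simp⟩]
    · rw [hf', cosetForm_single, if_neg hv]

/-! ### The subalgebra `Hbar` -/

variable (N) in
/-- The finite Weyl group as a subgroup of the affine Weyl group. -/
def finSubgroup : Subgroup (AffW N) := (SemidirectProduct.inr : Equiv.Perm (Fin N) →* AffW N).range

omit [NeZero N] in
theorem fin_mem_finSubgroup (σ : Equiv.Perm (Fin N)) : fin σ ∈ finSubgroup N := ⟨σ, rfl⟩

variable (N) in
/-- The homomorphism from `W` to `Hbar` which forgets translations. -/
noncomputable def barWHom : AffW N →* Hbar N where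
  toFun w := barW w.right
  map_one' := Subtype.ext (map_one (ofWHom N))
  map_mul' v w := Subtype.ext ((congrArg (ofWHom N) (fin_mul v.right w.right)).trans (map_mul _ _ _))

variable (N) in
/-- The linear map from `𝔱'` to `Hbar` which forgets the central component. -/
noncomputable def barTLin : TPrime N →ₗ[ℂ] Hbar N where
  toFun ξ := barT ξ.1
  map_add' ξ η := Subtype.ext ((congrArg (ofTLin N) (by simp)).trans
    (map_add (ofTLin N) (ξ.1, 0) (η.1, 0)))
  map_smul' a ξ := Subtype.ext ((congrArg (ofTLin N) (by simp)).trans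
    (map_smul (ofTLin N) a (ξ.1, 0)))

theorem coe_barWHom {w : AffW N} (hw : w ∈ finSubgroup N) :
    (barWHom N w : H N) = ofWHom N w := by
  obtain ⟨σ, rfl⟩ := hw
  rfl

theorem coe_barTLin {ξ : TPrime N} (hξ : ξ.2 = 0) : (barTLin N ξ : H N) = ofTLin N ξ := by
  obtain ⟨ξ, t⟩ := ξ
  obtain rfl : t = 0 := hξ
  rfl

/-- For `j ≠ 0` the reflection is a finite permutation preserving `𝔱bar`, so forgetting translations
and the central component loses nothing and the relation is that of `H`. -/
theorem satisfiesRefl_barW {j : Fin N} (hj : j ≠ 0) :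
    SatisfiesRefl (barWHom N) (barTLin N) j := fun ξ => by
  have h₁ : barTLin N ξ = barTLin N (ξ.1, 0) := rfl
  have h₂ : barTLin N (actT (simpleRefl j) ξ) = barTLin N (actT (simpleRefl j) (ξ.1, 0)) := rfl
  have h₃ : rootEval (simpleRoot j) ξ = rootEval (simpleRoot j) (ξ.1, 0) := rfl
  have h₄ : (actT (simpleRefl j) ((ξ.1, 0) : TPrime N)).2 = 0 := by
    rw [simpleRefl_of_ne_zero hj, actT_eq]
    simp
  refine Subtype.ext ?_
  have h := satisfiesRefl_ofW j ((ξ.1, 0) : TPrime N)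
  have hm : simpleRefl j ∈ finSubgroup N := ⟨_, (simpleRefl_of_ne_zero hj).symm⟩
  rw [h₁, h₂, h₃]
  simp only [Subalgebra.coe_sub, Subalgebra.coe_mul, coe_barWHom hm, coe_barTLin h₄,
    coe_barTLin (show ((ξ.1, 0) : TPrime N).2 = 0 from rfl)]
  exact h

theorem wordPhi_bar {js : List (Fin N)} (hjs : ∀ j ∈ js, j ≠ 0) :
    ((wordPhi (barWHom N) (barTLin N) js : Hbar N) : H N) = wordPhi (ofWHom N) (ofTLin N) js := by
  induction js with
  | nil => rfl
  | cons j js ih =>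
    rw [List.forall_mem_cons] at hjs
    have hm : simpleRefl j ∈ finSubgroup N := ⟨_, (simpleRefl_of_ne_zero hjs.1).symm⟩
    have ht : (coroot (simpleRoot j)).2 = 0 := by
      simp [simpleRoot_of_ne_zero hjs.1, root, coroot]
    rw [wordPhi_cons, wordPhi_cons, Subalgebra.coe_mul, ih hjs.2, intertwiner, intertwiner,
      Subalgebra.coe_add, Subalgebra.coe_mul, coe_barWHom hm, coe_barTLin ht, Subalgebra.coe_one]

theorem isRealization_Hbar (β : Composition N) :
    IsRealization β (finSubgroup N) (barWHom N) (barTLin N) where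
  comm ξ η := Subtype.ext (ofT_comm _ _)
  refl_mem w hw e he j hj := by
    obtain ⟨σ, rfl⟩ := hw
    exact ⟨_, (simpleRefl_of_ne_zero ((IsReducedExpr.of_fin he).2 j hj)).symm⟩
  refl w hw e he j hj := by
    obtain ⟨σ, rfl⟩ := hw
    exact satisfiesRefl_barW ((IsReducedExpr.of_fin he).2 j hj)
  pi_mem w hw e he := by
    obtain ⟨σ, rfl⟩ := hw
    rw [(IsReducedExpr.of_fin he).1, zpow_zero]
    exact one_mem _
  pi w hw e he ξ := by
    obtain ⟨σ, rfl⟩ := hw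
    rw [(IsReducedExpr.of_fin he).1, zpow_zero, map_one, one_mul, actT_one, mul_one]
  fin_mem u _ := fin_mem_finSubgroup u
  adjoin := by
    refine eq_top_iff.2 fun x _ => ?_
    have key : ∀ a (ha : a ∈ Hbar N), (⟨a, ha⟩ : Hbar N) ∈
        Algebra.adjoin ℂ (barWHom N '' finSubgroup N ∪ Set.range (barTLin N)) := by
      intro a ha
      induction ha using Algebra.adjoin_induction with
      | mem a ha =>
        rcases ha with ⟨σ, rfl⟩ | ⟨ξ, rfl⟩
        · exact Algebra.subset_adjoin (Or.inl ⟨fin σ, fin_mem_finSubgroup σ, rfl⟩)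
        · exact Algebra.subset_adjoin (Or.inr ⟨(ξ, 0), rfl⟩)
      | algebraMap c => exact Subalgebra.algebraMap_mem _ c
      | add a b _ _ ha hb => exact add_mem ha hb
      | mul a b _ _ ha hb => exact mul_mem ha hb
    exact key x x.2

theorem phi_fin_eq (σ : Equiv.Perm (Fin N)) : ∃ e, IsReducedExpr (fin σ) e ∧
    phi (fin σ) = (barWHom N (piElt N ^ e.1) * wordPhi (barWHom N) (barTLin N) e.2 : Hbar N) := by
  obtain ⟨e, he, hphi⟩ := phi_eq (fin σ)
  have h := he.of_fin
  refine ⟨e, he, ?_⟩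
  rw [Subalgebra.coe_mul, wordPhi_bar h.2, hphi, h.1, zpow_zero, map_one, map_one,
    Subalgebra.coe_one]

theorem phi_fin_mem (σ : Equiv.Perm (Fin N)) : phi (fin σ) ∈ Hbar N := by
  obtain ⟨e, -, h⟩ := phi_fin_eq σ
  rw [h]
  exact SetLike.coe_mem _

/-- The extension of a weight of `𝔱bar` by zero on the central element. -/
def extendWeight (ζ : Module.Dual ℂ (Fin N → ℂ)) : Module.Dual ℂ (TPrime N) :=
  ζ.comp (LinearMap.fst ℂ _ _)

variable {ζ : Module.Dual ℂ (Fin N → ℂ)}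

omit [NeZero N] in
theorem extendWeight_mem (hζ : ζ ∈ barWeights β) : extendWeight ζ ∈ weights β := hζ

theorem coe_mem_parabolicH {x : Hbar N} (hx : x ∈ parabolicHbar β) : (x : H N) ∈ parabolicH β := by
  induction hx using Algebra.adjoin_induction with
  | mem x hx =>
    rcases hx with ⟨σ, hσ, rfl⟩ | ⟨ξ, rfl⟩
    · exact Algebra.subset_adjoin (Or.inl ⟨σ, hσ, rfl⟩)
    · exact Algebra.subset_adjoin (Or.inr ⟨(ξ, 0), rfl⟩)
  | algebraMap c => exact Subalgebra.algebraMap_mem _ c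
  | add a b _ _ ha hb => exact add_mem ha hb
  | mul a b _ _ ha hb => exact mul_mem ha hb

/-- The character of the parabolic subalgebra of `Hbar` attached to `ζ`. -/
noncomputable def barParabolicChar (hζ : ζ ∈ barWeights β) : parabolicHbar β →ₐ[ℂ] ℂ :=
  (parabolicChar (extendWeight_mem hζ)).comp
    (((Hbar N).val.comp (parabolicHbar β).val).codRestrict (parabolicH β)
      fun x => coe_mem_parabolicH x.2)

theorem barParabolicChar_apply (hζ : ζ ∈ barWeights β) (x : parabolicHbar β) :
    barParabolicChar hζ x =
      parabolicChar (extendWeight_mem hζ) ⟨((x : Hbar N) : H N), coe_mem_parabolicH x.2⟩ := rfl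

theorem barParabolicChar_isBarCharacter (hζ : ζ ∈ barWeights β) :
    IsBarCharacter β ζ (barParabolicChar hζ) := by
  have h := parabolicChar_isCharacter (extendWeight_mem hζ)
  refine ⟨fun x σ hσ hx => ?_, fun x ξ hx => ?_⟩
  · rw [barParabolicChar_apply]
    exact h.1 _ σ hσ (congrArg Subtype.val hx)
  · rw [barParabolicChar_apply, h.2 _ (ξ, 0) (congrArg Subtype.val hx)]
    rfl

theorem isInducedFamily_Hbar (hζ : ζ ∈ barWeights β) (hgen : IsBarGeneric β ζ) :
    IsInducedFamily β (finSubgroup N) (barWHom N) (barTLin N) (extendWeight ζ)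
      (cyclicVector (barParabolicChar hζ))
      (fun σ : barCosetReps β => fin (σ : Equiv.Perm (Fin N)))
      (fun σ : barCosetReps β => (⟨phi (fin (σ : Equiv.Perm (Fin N))), phi_fin_mem _⟩ : Hbar N) •
        cyclicVector (barParabolicChar hζ)) where
  toIsRealization := isRealization_Hbar β
  weight ξ := by
    have hmem : barT ξ.1 ∈ parabolicHbar β := Algebra.subset_adjoin (Or.inr ⟨ξ.1, rfl⟩)
    have := smul_cyclicVector (barParabolicChar hζ) ⟨barT ξ.1, hmem⟩
    rwa [(barParabolicChar_isBarCharacter hζ).2 _ ξ.1 rfl] at this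
  fixed u hu := by
    have hmem : barW u ∈ parabolicHbar β := Algebra.subset_adjoin (Or.inl ⟨u, hu, rfl⟩)
    have := smul_cyclicVector (barParabolicChar hζ) ⟨barW u, hmem⟩
    rwa [(barParabolicChar_isBarCharacter hζ).1 _ u hu rfl, one_smul] at this
  gen := exists_smul_cyclicVector _
  injective σ τ h := Subtype.ext (SemidirectProduct.inr_injective h)
  mem σ := fin_mem_finSubgroup _
  mem_cosetReps σ := σ.2
  surjective w hw hmin := by
    obtain ⟨σ, rfl⟩ := hw
    exact ⟨⟨σ, hmin⟩, rfl⟩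
  vec_eq σ := by
    obtain ⟨e, he, hphi⟩ := phi_fin_eq (σ : Equiv.Perm (Fin N))
    refine ⟨e, he, ?_⟩
    rw [← mul_smul]
    congr 1
    exact Subtype.ext hphi
  generic σ a ha := hgen σ σ.2 a ⟨ha, inversions_fin_subset _ ha⟩
  form σ := by
    -- The separating forms come from restricting to `Hbar` the principal series of `H` at the
    -- weight extended by `ζ(c) = 0`.
    obtain ⟨f, hf⟩ := exists_inducedForm (χ := barParabolicChar hζ)
      ((cosetForm β (fin (σ : Equiv.Perm (Fin N)))).comp
        ((LinearMap.applyₗ (Finsupp.single 1 1)).comp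
          ((principal (extendWeight ζ)).toLinearMap.comp (Hbar N).val.toLinearMap)))
      (fun a b => cosetForm_principal_mul (extendWeight_mem hζ) _ (a : H N)
        ⟨((b : Hbar N) : H N), coe_mem_parabolicH b.2⟩)
    have hf' : ∀ v ∈ finSubgroup N, f (barWHom N v • cyclicVector (barParabolicChar hζ)) =
        cosetForm β (fin (σ : Equiv.Perm (Fin N))) (Finsupp.single v 1) := fun v hv => by
      rw [hf]
      change cosetForm β _ (principal _ (barWHom N v : H N) _) = _
      rw [coe_barWHom hv]
      change cosetForm β _ (principal _ (ofW v) _) = _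
      rw [principal_ofW, leftMul_single, mul_one]
    refine ⟨f, ?_, fun v hv hne => ?_⟩
    · rw [hf' _ (fin_mem_finSubgroup _), cosetForm_single, if_pos ⟨1, one_mem _, by simp⟩]
    · rw [hf' v hv, cosetForm_single, if_neg hne]

end Generators

end DDAHA

/-! ### The proposition for `H` and for `Hbar` -/

theorem mainTheorem2 (N : ℕ) [NeZero N] (β : Composition N) :
    (∀ ζ ∈ DDAHA.weights β, DDAHA.IsGeneric β ζ →
      ∃ χ : DDAHA.parabolicH β →ₐ[ℂ] ℂ, DDAHA.IsCharacter β ζ χ ∧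
        (ζ (DDAHA.central N) ≠ 0 → IsSimpleModule (DDAHA.H N) (DDAHA.Induced χ)) ∧
        DDAHA.IsBasis
          (fun w : DDAHA.cosetReps β => DDAHA.phi (w : DDAHA.AffW N) • DDAHA.cyclicVector χ)) ∧
    (∀ ζ ∈ DDAHA.barWeights β, DDAHA.IsBarGeneric β ζ →
      ∃ χ : DDAHA.parabolicHbar β →ₐ[ℂ] ℂ, DDAHA.IsBarCharacter β ζ χ ∧
        IsSimpleModule (DDAHA.Hbar N) (DDAHA.Induced χ) ∧
        ∃ hφ : ∀ σ : Equiv.Perm (Fin N), DDAHA.phi (DDAHA.fin σ) ∈ DDAHA.Hbar N,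
          DDAHA.IsBasis
            (fun σ : DDAHA.barCosetReps β =>
              (⟨DDAHA.phi (DDAHA.fin (σ : Equiv.Perm (Fin N))), hφ σ⟩ : DDAHA.Hbar N) •
                DDAHA.cyclicVector χ)) := by
  refine ⟨fun ζ hζ hgen => ?_, fun ζ hζ hgen => ?_⟩
  · have h := DDAHA.isInducedFamily_H hζ hgen
    exact ⟨_, DDAHA.parabolicChar_isCharacter hζ, fun hc => h.isSimpleModule fun x _ hx hfix =>
      DDAHA.exists_inversion_of_fixed hx hfix (Or.inl hc), h.isBasis⟩
  · have h := DDAHA.isInducedFamily_Hbar hζ hgen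
    refine ⟨_, DDAHA.barParabolicChar_isBarCharacter hζ, h.isSimpleModule fun x hx hx₁ hfix =>
      DDAHA.exists_inversion_of_fixed hx₁ hfix (Or.inr ?_), DDAHA.phi_fin_mem, h.isBasis⟩
    obtain ⟨τ, rfl⟩ := hx
    exact ⟨τ, rfl⟩
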